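/- Let $R$ be a (commutative Noetherian) Cohen–Macaulay local ring with maximal ideal $\mathfrak m$ which admits a canonical module. All modules are finitely generated, and $\mathrm{CM}(R)$ denotes the full subcategory of maximal Cohen–Macaulay $R$-modules, that is, modules $M$ with $M=0$ or $\operatorname{depth} M=\dim R$. Subcategories are full and closed under isomorphism. For a subcategory $\mathcal X$ let $|\mathcal X|=\operatorname{add}\mathcal X$ be the subcategory of direct summands of finite direct sums of modules in $\mathcal X$, and let $[\mathcal X]$ be the additive closure $\operatorname{add}$ of the subcategory consisting of $R$ and all $\Omega^iX$ with $i\ge 0$ and $X\in\mathcal X$, where $\Omega^i$ is the $i$-th syzygy in a minimal free resolution and $\Omega^0X=X$. Let $\mathcal X\circ\mathcal Y$ be the subcategory of the modules $M$ fitting into an exact sequence $0\to X\to M\to Y\to 0$ with $X\in\mathcal X$ and $Y\in\mathcal Y$. For a module $G$, put $|G|_1=|\{G\}|$ and $[G]_1=[\{G\}]$, and for $r\ge 2$ put $|G|_r=\big|\,\big||G|_{r-1}\big|\circ|G|_1\,\big|$ and $[G]_r=\big[\,\big[[G]_{r-1}\big]\circ[G]_1\,\big]$. For a subcategory $\mathcal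 X$ define, as elements of $\mathbb N\cup\{\infty\}$ (with $\inf\emptyset=\infty$), $$\operatorname{size}\mathcal X=\inf\{n\ge0:\mathcal X\subseteq|G|_{n+1}\text{ for some }G\},\qquad \operatorname{rank}\mathcal X=\inf\{n\ge0:\mathcal X=|G|_{n+1}\text{ for some }G\},$$ $$\operatorname{radius}\mathcal X=\inf\{n\ge0:\mathcal X\subseteq[G]_{n+1}\text{ for some }G\},\qquad \dim\mathcal X=\inf\{n\ge0:\mathcal X=[G]_{n+1}\text{ for some }G\},$$ where $G$ ranges over all finitely generated $R$-modules. Then: 1. If $\operatorname{size}\mathrm{CM}(R)<\infty$, then $\operatorname{rank}\mathrm{CM}(R)<(\dim R+1)(\operatorname{size}\mathrm{CM}(R)+1)$. 2. If $\operatorname{radius}\mathrm{CM}(R)<\infty$, then $\dim\mathrm{CM}(R)<(\dim R+1)(\operatorname{radius}\mathrm{CM}(R)+1)$. In particular, $$\operatorname{rank}\mathrm{CM}(R)<\infty\iff\operatorname{size}\mathrm{CM}(R)<\infty\implies\dim\mathrm{CM}(R)<\infty\iff\operatorname{radius}\mathrm{CM}(R)<\infty.$$ -/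

import Mathlib

universe u

namespace ModSubcat

open CategoryTheory CategoryTheory.Abelian IsLocalRing

/-! ### Depth, maximal Cohen-Macaulay modules, canonical modules -/

section CohenMacaulay

variable (R : Type u) [CommRing R] [IsLocalRing R]

/-- The depth of a nonzero finitely generated module `M` over a local ring: the supremum of the
lengths of the `M`-regular sequences contained in the maximal ideal. (The value at the zero module
is irrelevant: that module is always treated separately.) -/
noncomputable def depth (M : Type u) [AddCommGroup M] [Module R M] : ℕ∞ :=
  ⨆ (rs : List R) (_ : (∀ r ∈ rs, r ∈ maximalIdeal R) ∧ RingTheory.Sequence.IsRegular M rs),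
    (rs.length : ℕ∞)

/-- A (Noetherian) local ring is Cohen-Macaulay if its depth equals its Krull dimension. -/
def IsCohenMacaulayRing : Prop :=
  (depth R R : WithBot ℕ∞) = ringKrullDim R

/-- The subcategory `CM(R)` of maximal Cohen-Macaulay modules: the finitely generated modules `M`
with `M = 0` or `depth M = dim R`. -/
def CM : ObjectProperty (ModuleCat.{u} R) := fun M =>
  Module.Finite R M ∧ (Subsingleton M ∨ (depth R M : WithBot ℕ∞) = ringKrullDim R)

variable {R} in
/-- A canonical module of a (Cohen-Macaulay, Noetherian) local ring with residue field `k` and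
dimension `d`: a maximal Cohen-Macaulay module `ω` of finite injective dimension and of type one,
that is, `Ext^d(k, ω)` is one-dimensional over `k`. -/
structure IsCanonicalModule (ω : ModuleCat.{u} R) : Prop where
  maximal_cohenMacaulay : CM R ω
  finite_injectiveDimension : ∃ n : ℕ, HasInjectiveDimensionLE ω n
  type_one : ∃ d : ℕ, (d : WithBot ℕ∞) = ringKrullDim R ∧
    Nonempty (Ext (ModuleCat.of R (ResidueField R)) ω d ≃ₗ[R] ResidueField R)

end CohenMacaulay

/-! ### Operations on subcategories -/

section Operations

variable {R : Type u} [CommRing R]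

/-- The (strict, full) subcategory consisting of the modules isomorphic to `G`. -/
def single (G : ModuleCat.{u} R) : ObjectProperty (ModuleCat.{u} R) := fun M =>
  Nonempty (M ≃ₗ[R] G)

/-- The additive closure `add X`: the direct summands (retracts) of finite direct sums of modules
in `X`. -/
def addClosure (X : ObjectProperty (ModuleCat.{u} R)) : ObjectProperty (ModuleCat.{u} R) :=
  fun M => ∃ (n : ℕ) (F : Fin n → ModuleCat.{u} R), (∀ i, X (F i)) ∧
    ∃ (s : M →ₗ[R] ((i : Fin n) → F i)) (p : ((i : Fin n) → F i) →ₗ[R] M),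
      p ∘ₗ s = LinearMap.id

/-- `X ∘ Y`: the modules `M` that fit into an exact sequence `0 → A → M → B → 0` with `A` in `X`
and `B` in `Y`. -/
def ext (X Y : ObjectProperty (ModuleCat.{u} R)) : ObjectProperty (ModuleCat.{u} R) :=
  fun M => ∃ A B : ModuleCat.{u} R, X A ∧ Y B ∧ ∃ (f : A →ₗ[R] M) (g : M →ₗ[R] B),
    Function.Injective f ∧ Function.Exact f g ∧ Function.Surjective g

/-- `X * Y = ||X| ∘ |Y||`, where `|X| = add X`. -/
def star (X Y : ObjectProperty (ModuleCat.{u} R)) : ObjectProperty (ModuleCat.{u} R) :=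
  addClosure (ext (addClosure X) (addClosure Y))

/-- `|X|_r` for `r ≥ 1`: `|X|_1 = |X|` and `|X|_r = |X|_{r-1} * X` for `r ≥ 2`.
(The value at `r = 0` is never used.) -/
def addBall (X : ObjectProperty (ModuleCat.{u} R)) : ℕ → ObjectProperty (ModuleCat.{u} R)
  | 0 => fun _ => False
  | 1 => addClosure X
  | r + 2 => star (addBall X (r + 1)) X

variable [IsLocalRing R]

/-- `N` is a first syzygy `Ω M` of `M`: it is isomorphic to the kernel of a minimal free cover
`R^n → M`, i.e. of a surjection whose kernel is contained in `𝔪 R^n`. -/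
def IsSyzygy (M N : ModuleCat.{u} R) : Prop :=
  ∃ (n : ℕ) (f : (Fin n → R) →ₗ[R] M), Function.Surjective f ∧
    LinearMap.ker f ≤ maximalIdeal R • (⊤ : Submodule R (Fin n → R)) ∧
    Nonempty (N ≃ₗ[R] LinearMap.ker f)

/-- `N` is an `i`-th syzygy `Ω^i M` of `M` in a minimal free resolution, with `Ω^0 M = M`. -/
def IsNthSyzygy : ℕ → ModuleCat.{u} R → ModuleCat.{u} R → Prop
  | 0, M, N => Nonempty (N ≃ₗ[R] M)
  | i + 1, M, N => ∃ K : ModuleCat.{u} R, IsSyzygy M K ∧ IsNthSyzygy i K N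

/-- `[X]`: the additive closure of the subcategory consisting of `R` and all the `Ω^i A` with
`i ≥ 0` and `A` in `X`. -/
def bracket (X : ObjectProperty (ModuleCat.{u} R)) : ObjectProperty (ModuleCat.{u} R) :=
  addClosure fun N => Nonempty (N ≃ₗ[R] R) ∨
    ∃ (i : ℕ) (A : ModuleCat.{u} R), X A ∧ IsNthSyzygy i A N

/-- `X • Y = [[X] ∘ [Y]]`. -/
def bullet (X Y : ObjectProperty (ModuleCat.{u} R)) : ObjectProperty (ModuleCat.{u} R) :=
  bracket (ext (bracket X) (bracket Y))

/-- `[X]_r` for `r ≥ 1`, the ball of radius `r` centered at `X`: `[X]_1 = [X]` and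
`[X]_r = [X]_{r-1} • X` for `r ≥ 2`. (The value at `r = 0` is never used.) -/
def ball (X : ObjectProperty (ModuleCat.{u} R)) : ℕ → ObjectProperty (ModuleCat.{u} R)
  | 0 => fun _ => False
  | 1 => bracket X
  | r + 2 => bullet (ball X (r + 1)) X

end Operations

/-! ### The four invariants of a subcategory -/

section Invariants

variable {R : Type u} [CommRing R]

/-- The infimum of the integers `n ≥ 0` such that `X ⊆ |G|_{n+1}` for some finitely generated
module `G` (`⊤` if there is none). -/
noncomputable def size (X : ObjectProperty (ModuleCat.{u} R)) : ℕ∞ :=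
  ⨅ (n : ℕ) (_ : ∃ G : ModuleCat.{u} R, Module.Finite R G ∧
    X ≤ addBall (single G) (n + 1)), (n : ℕ∞)

/-- The infimum of the integers `n ≥ 0` such that `X = |G|_{n+1}` for some finitely generated
module `G` (`⊤` if there is none). -/
noncomputable def rank (X : ObjectProperty (ModuleCat.{u} R)) : ℕ∞ :=
  ⨅ (n : ℕ) (_ : ∃ G : ModuleCat.{u} R, Module.Finite R G ∧
    X = addBall (single G) (n + 1)), (n : ℕ∞)

variable [IsLocalRing R]

/-- The infimum of the integers `n ≥ 0` such that `X ⊆ [G]_{n+1}` for some finitely generated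
module `G` (`⊤` if there is none). -/
noncomputable def radius (X : ObjectProperty (ModuleCat.{u} R)) : ℕ∞ :=
  ⨅ (n : ℕ) (_ : ∃ G : ModuleCat.{u} R, Module.Finite R G ∧
    X ≤ ball (single G) (n + 1)), (n : ℕ∞)

/-- The infimum of the integers `n ≥ 0` such that `X = [G]_{n+1}` for some finitely generated
module `G` (`⊤` if there is none). -/
noncomputable def dim (X : ObjectProperty (ModuleCat.{u} R)) : ℕ∞ :=
  ⨅ (n : ℕ) (_ : ∃ G : ModuleCat.{u} R, Module.Finite R G ∧
    X = ball (single G) (n + 1)), (n : ℕ∞)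

end Invariants

end ModSubcat

/-! Let d = dim R, let ω be a canonical module, and suppose CM(R) ⊆ |G|_{n+1}. The only obstacle to
equality is that G need not be maximal Cohen–Macaulay. The centre is improved by replacing G with H
= ΩG ⊕ R ⊕ ω: this raises a depth below d by at least one and costs one more extension.

The cost comes from duality. A maximal Cohen–Macaulay N sits in 0 → N → ω^m → N' → 0 with N' again
maximal Cohen–Macaulay (`exists_embedding_pi`). Since N' ∈ |G|_r, Schanuel and the horseshoe lemma
give a projective cover P → N' with kernel K ∈ |H|_r (`addBall_le_hasCoverWithKernelIn`). The
pullback E of P and ω^m over N' is an extension of ω^m by K, and it contains N as a summand because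
E → P splits (`addClosure_ext_of_exact`). Hence N ∈ |H|_{r+1}.

After d such steps the centre H is itself maximal Cohen–Macaulay. As CM(R) is closed under
extensions and summands, CM(R) = |H|_{n+d+1}, and n + d < (d+1)(n+1). The same argument works for
balls [G]_r, since CM(R) contains R and is closed under syzygies.

The embedding into ω^m is obtained without a full duality theory. Generators of Hom(M, ω) define F :
M → ω^m. Let J be generated by a maximal regular sequence on R, M and ω. Maps M/JM → ω/Jω separate
points because Ext^d(k, ω) ≠ 0 and Ext^{d+1}(-, ω) vanishes on finitely generated modules; such maps
lift to M → ω because Ext^{>0}(M, ω) = 0. So F is injective modulo J, and Nakayama turns this into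
injectivity of F and regularity of its cokernel. -/

namespace ModSubcat

open CategoryTheory CategoryTheory.Abelian IsLocalRing RingTheory.Sequence
open scoped Pointwise

/-! ### Vanishing of Ext along short exact sequences, summands and regular elements -/

section ExtVanishing

variable {R : Type u} [CommRing R]

theorem shortExact_ofHom {A B C : ModuleCat.{u} R} {f : A →ₗ[R] B} {g : B →ₗ[R] C}
    (hf : Function.Injective f) (hfg : Function.Exact f g) (hg : Function.Surjective g) :
    ∃ w, (ShortComplex.mk (ModuleCat.ofHom f) (ModuleCat.ofHom g) w :
      ShortComplex (ModuleCat.{u} R)).ShortExact :=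
  ⟨by ext x; exact hfg.apply_apply_eq_zero x, ModuleCat.shortComplex_shortExact _ hfg hf hg⟩

variable {A B C : ModuleCat.{u} R} {f : A →ₗ[R] B} {g : B →ₗ[R] C}

theorem subsingleton_ext_middle_right (hf : Function.Injective f) (hfg : Function.Exact f g)
    (hg : Function.Surjective g) (N : ModuleCat.{u} R) {i : ℕ}
    (hA : Subsingleton (Ext N A i)) (hC : Subsingleton (Ext N C i)) :
    Subsingleton (Ext N B i) := by
  obtain ⟨w, hS⟩ := shortExact_ofHom hf hfg hg
  refine subsingleton_of_forall_eq 0 fun e => ?_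
  obtain ⟨a, rfl⟩ := Ext.covariant_sequence_exact₂ N hS e (hC.elim _ _)
  rw [hA.elim a 0, Ext.zero_comp]

theorem subsingleton_ext_left_right (hf : Function.Injective f) (hfg : Function.Exact f g)
    (hg : Function.Surjective g) (N : ModuleCat.{u} R) {i : ℕ}
    (hC : Subsingleton (Ext N C i)) (hB : Subsingleton (Ext N B (i + 1))) :
    Subsingleton (Ext N A (i + 1)) := by
  obtain ⟨w, hS⟩ := shortExact_ofHom hf hfg hg
  refine subsingleton_of_forall_eq 0 fun e => ?_
  obtain ⟨a, rfl⟩ := Ext.covariant_sequence_exact₁ N hS e (hB.elim _ _) rfl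
  rw [hC.elim a 0, Ext.zero_comp]

theorem subsingleton_ext_zero_left_right (hf : Function.Injective f) (N : ModuleCat.{u} R)
    (hB : Subsingleton (Ext N B 0)) : Subsingleton (Ext N A 0) := by
  have hm : Mono (ModuleCat.ofHom f) := (ModuleCat.mono_iff_injective _).mpr hf
  exact (Ext.postcomp_mk₀_injective_of_mono N (ModuleCat.ofHom f)).subsingleton

theorem subsingleton_ext_right_right (hf : Function.Injective f) (hfg : Function.Exact f g)
    (hg : Function.Surjective g) (N : ModuleCat.{u} R) {i : ℕ}
    (hB : Subsingleton (Ext N B i)) (hA : Subsingleton (Ext N A (i + 1))) :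
    Subsingleton (Ext N C i) := by
  obtain ⟨w, hS⟩ := shortExact_ofHom hf hfg hg
  refine subsingleton_of_forall_eq 0 fun e => ?_
  obtain ⟨a, rfl⟩ := Ext.covariant_sequence_exact₃ N hS e rfl (hA.elim _ _)
  rw [hB.elim a 0, Ext.zero_comp]

theorem subsingleton_ext_middle_left (hf : Function.Injective f) (hfg : Function.Exact f g)
    (hg : Function.Surjective g) (Y : ModuleCat.{u} R) {i : ℕ}
    (hA : Subsingleton (Ext A Y i)) (hC : Subsingleton (Ext C Y i)) :
    Subsingleton (Ext B Y i) := by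
  obtain ⟨w, hS⟩ := shortExact_ofHom hf hfg hg
  refine subsingleton_of_forall_eq 0 fun e => ?_
  obtain ⟨a, rfl⟩ := Ext.contravariant_sequence_exact₂ hS Y e (hA.elim _ _)
  rw [hC.elim a 0, Ext.comp_zero]

theorem subsingleton_ext_left_left (hf : Function.Injective f) (hfg : Function.Exact f g)
    (hg : Function.Surjective g) (Y : ModuleCat.{u} R) {i : ℕ}
    (hB : Subsingleton (Ext B Y i)) (hC : Subsingleton (Ext C Y (i + 1))) :
    Subsingleton (Ext A Y i) := by
  obtain ⟨w, hS⟩ := shortExact_ofHom hf hfg hg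
  refine subsingleton_of_forall_eq 0 fun e => ?_
  obtain ⟨a, rfl⟩ := Ext.contravariant_sequence_exact₁ hS Y e (add_comm 1 i) (hC.elim _ _)
  rw [hB.elim a 0, Ext.comp_zero]

theorem subsingleton_ext_of_retract_right {M M' : ModuleCat.{u} R} (s : M →ₗ[R] M')
    (p : M' →ₗ[R] M) (h : p ∘ₗ s = LinearMap.id) (N : ModuleCat.{u} R) {i : ℕ}
    (hM' : Subsingleton (Ext N M' i)) : Subsingleton (Ext N M i) := by
  refine subsingleton_of_forall_eq 0 fun e => ?_
  have hsp : ModuleCat.ofHom s ≫ ModuleCat.ofHom p = 𝟙 M := by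
    rw [← ModuleCat.ofHom_comp, h]; rfl
  have h0 : (e.comp (Ext.mk₀ (ModuleCat.ofHom s)) (add_zero i) : Ext N M' i) = 0 := hM'.elim _ _
  calc e = e.comp (Ext.mk₀ (𝟙 M)) (add_zero i) := (Ext.comp_mk₀_id e).symm
    _ = (e.comp (Ext.mk₀ (ModuleCat.ofHom s)) (add_zero i)).comp
          (Ext.mk₀ (ModuleCat.ofHom p)) (add_zero i) := by
        rw [← hsp, ← Ext.mk₀_comp_mk₀, Ext.comp_assoc_of_third_deg_zero]
    _ = 0 := by rw [h0, Ext.zero_comp]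

theorem subsingleton_ext_of_subsingleton_right {M : ModuleCat.{u} R} [Subsingleton M]
    (N : ModuleCat.{u} R) (i : ℕ) : Subsingleton (Ext N M i) := by
  refine subsingleton_of_forall_eq 0 fun e => ?_
  have h : 𝟙 M = 0 := by ext x; exact Subsingleton.elim _ _
  rw [← Ext.comp_mk₀_id e, h, Ext.mk₀_zero, Ext.comp_zero]

theorem subsingleton_ext_of_subsingleton_left {N : ModuleCat.{u} R} [Subsingleton N]
    (M : ModuleCat.{u} R) (i : ℕ) : Subsingleton (Ext N M i) := by
  refine subsingleton_of_forall_eq 0 fun e => ?_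
  have h : 𝟙 N = 0 := by ext x; exact Subsingleton.elim _ _
  rw [← Ext.mk₀_id_comp e, h, Ext.mk₀_zero, Ext.zero_comp]

theorem subsingleton_ext_pi_right {n : ℕ} (F : Fin n → ModuleCat.{u} R) (N : ModuleCat.{u} R)
    {i : ℕ} (h : ∀ j, Subsingleton (Ext N (F j) i)) :
    Subsingleton (Ext N (ModuleCat.of R ((j : Fin n) → F j)) i) := by
  refine subsingleton_of_forall_eq 0 fun e => ?_
  let P : ModuleCat.{u} R := ModuleCat.of R ((j : Fin n) → F j)
  let π (j : Fin n) : P ⟶ F j := ModuleCat.ofHom (LinearMap.proj j)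
  let ι (j : Fin n) : F j ⟶ P := ModuleCat.ofHom (LinearMap.single R (fun j => F j) j)
  have hsum : 𝟙 P = ∑ j, π j ≫ ι j := by
    refine ModuleCat.hom_ext (LinearMap.ext fun x => ?_)
    have : (∑ j, π j ≫ ι j).hom x = ∑ j, (π j ≫ ι j).hom x := by
      rw [ModuleCat.hom_sum, LinearMap.sum_apply]
    rw [this]
    exact (Finset.univ_sum_single x).symm
  rw [← Ext.comp_mk₀_id e]
  change e.comp (Ext.mk₀ (𝟙 P)) _ = 0
  rw [hsum, Ext.mk₀_sum, Ext.comp_sum]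
  refine Finset.sum_eq_zero fun j _ => ?_
  rw [← Ext.mk₀_comp_mk₀, ← Ext.comp_assoc_of_third_deg_zero]
  have : (e.comp (Ext.mk₀ (π j)) (add_zero i) : Ext N (F j) i) = 0 := (h j).elim _ _
  rw [this, Ext.zero_comp]

theorem ext_comp_mk₀_smul_id {N M : ModuleCat.{u} R} {i : ℕ} (e : Ext N M i) (x : R) :
    e.comp (Ext.mk₀ (x • 𝟙 M)) (add_zero i) = x • e := by
  rw [Ext.mk₀_smul, Ext.comp_smul, Ext.comp_mk₀_id]

theorem ext_mk₀_smul_id_comp {N M : ModuleCat.{u} R} {i : ℕ} (e : Ext N M i) (x : R) :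
    (Ext.mk₀ (x • 𝟙 N)).comp e (zero_add i) = x • e := by
  rw [Ext.mk₀_smul, Ext.smul_comp, Ext.mk₀_id_comp]

theorem smul_ext_eq_zero {N M : ModuleCat.{u} R} {i : ℕ} (e : Ext N M i) {x : R}
    (hx : ∀ n : N, x • n = 0) : x • e = 0 := by
  have h : x • 𝟙 N = 0 := by ext n; exact hx n
  rw [← ext_mk₀_smul_id_comp, h, Ext.mk₀_zero, Ext.zero_comp]

/-- Nakayama, in the form in which it is applied to Ext modules and to kernels: `E = xE` with `x ∈
𝔪`. -/
theorem subsingleton_of_forall_exists_smul [IsLocalRing R] {E : Type*} [AddCommGroup E]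
    [Module R E] [Module.Finite R E] {x : R} (hx : x ∈ maximalIdeal R)
    (h : ∀ e : E, ∃ e', x • e' = e) : Subsingleton E := by
  by_contra hE
  rw [not_subsingleton_iff_nontrivial] at hE
  refine Submodule.top_ne_pointwise_smul_of_mem_jacobson_annihilator (M := E) (r := x)
    (maximalIdeal_le_jacobson _ hx) (eq_comm.mp (eq_top_iff.mpr fun e _ => ?_))
  obtain ⟨e', rfl⟩ := h e
  exact Submodule.smul_mem_pointwise_smul _ _ _ trivial

/-- If `x ∈ 𝔪` is regular on `N`, then `Ext^i(N, Y) = 0` as soon as `Ext^{i+1}(N/xN, Y) = 0`. -/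
theorem subsingleton_ext_of_quotSMulTop [IsNoetherianRing R] [IsLocalRing R]
    {N Y : ModuleCat.{u} R} [Module.Finite R N] [Module.Finite R Y] {x : R}
    (hx : x ∈ maximalIdeal R) (hreg : IsSMulRegular N x) {i : ℕ}
    (h : Subsingleton (Ext (ModuleCat.of R (QuotSMulTop x N)) Y (i + 1))) :
    Subsingleton (Ext N Y i) := by
  refine subsingleton_of_forall_exists_smul hx fun e => ?_
  obtain ⟨e', he'⟩ := Ext.contravariant_sequence_exact₁ hreg.smulShortComplex_shortExact Y e
    (add_comm 1 i) (h.elim _ _)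
  exact ⟨e', (ext_mk₀_smul_id_comp e' x).symm.trans he'⟩

end ExtVanishing


/-! ### Depth through vanishing of Ext from the residue field -/

section Depth

variable {R : Type u} [CommRing R] [IsLocalRing R]

variable (R) in
/-- The residue field as an object of the category of modules. -/
noncomputable abbrev residueModule : ModuleCat.{u} R := ModuleCat.of R (ResidueField R)

/-- `Ext^i(k, M) = 0` for all `i < n`. For a finitely generated module `M` over a Noetherian local
ring this says that `M = 0` or that the depth of `M` is at least `n`. -/
def DepthGE (n : ℕ) (M : ModuleCat.{u} R) : Prop :=
  ∀ i < n, Subsingleton (Ext (residueModule R) M i)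

theorem DepthGE.mono {m n : ℕ} {M : ModuleCat.{u} R} (h : DepthGE n M) (hmn : m ≤ n) :
    DepthGE m M := fun i hi => h i (hi.trans_le hmn)

theorem DepthGE.of_retract {n : ℕ} {M M' : ModuleCat.{u} R} (h : DepthGE n M') (s : M →ₗ[R] M')
    (p : M' →ₗ[R] M) (hps : p ∘ₗ s = LinearMap.id) : DepthGE n M :=
  fun i hi => subsingleton_ext_of_retract_right s p hps _ (h i hi)

theorem DepthGE.of_equiv {n : ℕ} {M M' : ModuleCat.{u} R} (h : DepthGE n M') (e : M ≃ₗ[R] M') :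
    DepthGE n M :=
  h.of_retract e.toLinearMap e.symm.toLinearMap (by ext; simp)

theorem DepthGE.pi {n m : ℕ} {F : Fin m → ModuleCat.{u} R} (h : ∀ j, DepthGE n (F j)) :
    DepthGE n (ModuleCat.of R ((j : Fin m) → F j)) :=
  fun i hi => subsingleton_ext_pi_right F _ fun j => h j i hi

theorem DepthGE.of_subsingleton (n : ℕ) {M : ModuleCat.{u} R} [Subsingleton M] : DepthGE n M :=
  fun i _ => subsingleton_ext_of_subsingleton_right _ i

variable {A B C : ModuleCat.{u} R} {f : A →ₗ[R] B} {g : B →ₗ[R] C}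

theorem DepthGE.middle {n : ℕ} (hf : Function.Injective f) (hfg : Function.Exact f g)
    (hg : Function.Surjective g) (hA : DepthGE n A) (hC : DepthGE n C) : DepthGE n B :=
  fun i hi => subsingleton_ext_middle_right hf hfg hg _ (hA i hi) (hC i hi)

theorem DepthGE.left {n : ℕ} (hf : Function.Injective f) (hfg : Function.Exact f g)
    (hg : Function.Surjective g) (hB : DepthGE (n + 1) B) (hC : DepthGE n C) :
    DepthGE (n + 1) A := by
  intro i hi
  cases i with
  | zero => exact subsingleton_ext_zero_left_right hf _ (hB 0 hi)
  | succ i => exact subsingleton_ext_left_right hf hfg hg _ (hC i (by omega)) (hB _ hi)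

theorem DepthGE.left_of_le {n : ℕ} (hf : Function.Injective f) (hfg : Function.Exact f g)
    (hg : Function.Surjective g) (hB : DepthGE n B) (hC : DepthGE n C) : DepthGE n A := by
  cases n with
  | zero => intro i hi; omega
  | succ n => exact DepthGE.left hf hfg hg hB (hC.mono n.le_succ)

theorem DepthGE.prod {n : ℕ} {M N : ModuleCat.{u} R} (hM : DepthGE n M) (hN : DepthGE n N) :
    DepthGE n (ModuleCat.of R (M × N)) :=
  DepthGE.middle (A := M) (B := ModuleCat.of R (M × N)) (C := N) (f := LinearMap.inl R M N)
    (g := LinearMap.snd R M N)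
    LinearMap.inl_injective (Function.Exact.inl_snd) Prod.snd_surjective hM hN

theorem support_residueModule :
    Module.support R (residueModule R) = PrimeSpectrum.zeroLocus (maximalIdeal R) := by
  have h : Module.annihilator R (ResidueField R) = maximalIdeal R :=
    Ideal.annihilator_quotient (I := maximalIdeal R)
  rw [Module.support_eq_zeroLocus]
  change PrimeSpectrum.zeroLocus (Module.annihilator R (ResidueField R) : Set R) = _
  rw [h]

theorem maximalIdeal_smul_top_lt {M : ModuleCat.{u} R} [Module.Finite R M] [Nontrivial M] :
    maximalIdeal R • (⊤ : Submodule R M) < ⊤ :=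
  lt_top_iff_ne_top.mpr (Submodule.top_ne_ideal_smul_of_le_jacobson_annihilator
    (maximalIdeal_le_jacobson _)).symm

variable [IsNoetherianRing R]

theorem DepthGE.of_isWeaklyRegular {M : ModuleCat.{u} R} [Module.Finite R M] {rs : List R}
    (hmem : ∀ r ∈ rs, r ∈ maximalIdeal R) (h : IsWeaklyRegular M rs) : DepthGE rs.length M := by
  cases subsingleton_or_nontrivial M with
  | inl _ => exact DepthGE.of_subsingleton _
  | inr _ =>
    exact ModuleCat.subsingleton_ext_of_exists_isRegular (maximalIdeal R) (residueModule R)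
      support_residueModule.subset M maximalIdeal_smul_top_lt rs hmem
      ((isRegular_iff_isWeaklyRegular_of_subset_maximalIdeal hmem).mpr h)

theorem DepthGE.exists_isRegular {n : ℕ} {M : ModuleCat.{u} R} [Module.Finite R M] [Nontrivial M]
    (h : DepthGE n M) : ∃ rs : List R, rs.length = n ∧ (∀ r ∈ rs, r ∈ maximalIdeal R) ∧
      IsRegular M rs :=
  ModuleCat.exists_isRegular_of_exists_subsingleton_ext (maximalIdeal R) n M
    maximalIdeal_smul_top_lt (residueModule R) support_residueModule h

theorem DepthGE.le_depth {n : ℕ} {M : ModuleCat.{u} R} [Module.Finite R M] [Nontrivial M]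
    (h : DepthGE n M) : (n : ℕ∞) ≤ depth R M := by
  obtain ⟨rs, rfl, hmem, hreg⟩ := h.exists_isRegular
  exact le_iSup₂_of_le (f := fun (rs : List R) (_ : (∀ r ∈ rs, r ∈ maximalIdeal R) ∧
    IsRegular M rs) => (rs.length : ℕ∞)) rs ⟨hmem, hreg⟩ le_rfl

theorem DepthGE.of_le_depth {n : ℕ} {M : ModuleCat.{u} R} [Module.Finite R M]
    (h : (n : ℕ∞) ≤ depth R M) : DepthGE n M := by
  cases n with
  | zero => intro i hi; omega
  | succ n =>
    -- The supremum is not known to be attained; a strict inequality below it still yields a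
    -- sequence of length at least `n + 1`.
    have hlt : (n : ℕ∞) < depth R M := lt_of_lt_of_le (by exact_mod_cast n.lt_succ_self) h
    obtain ⟨rs, hrs⟩ := lt_iSup_iff.mp hlt
    obtain ⟨⟨hmem, hreg⟩, hlen⟩ := lt_iSup_iff.mp hrs
    exact (DepthGE.of_isWeaklyRegular hmem hreg.toIsWeaklyRegular).mono (by exact_mod_cast hlen)

/-- A regular sequence lowers the dimension of the support by its length, and the final quotient is
nonzero, so its support has dimension at least 0. -/
theorem depth_le_ringKrullDim (M : Type u) [AddCommGroup M] [Module R M] [Module.Finite R M]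
    {d : ℕ} (hd : ringKrullDim R = d) : depth R M ≤ d := by
  refine iSup₂_le fun rs hrs => ?_
  have h1 := Module.supportDim_add_length_eq_supportDim_of_isRegular rs hrs.2
  have : Nontrivial (M ⧸ (Ideal.ofList rs • (⊤ : Submodule R M))) :=
    Submodule.Quotient.nontrivial_iff.mpr hrs.2.top_ne_smul.symm
  have := (Module.nonempty_support_of_nontrivial (R := R)
    (M := M ⧸ (Ideal.ofList rs • (⊤ : Submodule R M)))).to_subtype
  have h2 : (0 : WithBot ℕ∞) ≤ Module.supportDim R (M ⧸ (Ideal.ofList rs • (⊤ : Submodule R M))) :=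
    Order.krullDim_nonneg
  have h3 : (rs.length : WithBot ℕ∞) ≤ d := by
    calc (rs.length : WithBot ℕ∞) = 0 + rs.length := (zero_add _).symm
      _ ≤ _ := by gcongr
      _ = _ := h1
      _ ≤ _ := Module.supportDim_le_ringKrullDim R M
      _ = d := hd
  exact_mod_cast h3

/-- `DepthGE` holds for the zero module, and depth never exceeds the dimension, so the two cases of
`CM` merge into one condition that visibly passes to summands and extensions. -/
theorem cm_iff {d : ℕ} (hd : ringKrullDim R = d) (M : ModuleCat.{u} R) :
    CM R M ↔ Module.Finite R M ∧ DepthGE d M := by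
  refine and_congr_right fun hfin => ?_
  rw [hd]
  constructor
  · rintro (h | h)
    · exact DepthGE.of_subsingleton d
    · exact DepthGE.of_le_depth (le_of_eq (by exact_mod_cast h.symm))
  · intro h
    cases subsingleton_or_nontrivial M with
    | inl h => exact Or.inl h
    | inr _ =>
      refine Or.inr ?_
      have := le_antisymm (depth_le_ringKrullDim M hd) h.le_depth
      rw [this]; rfl

theorem IsCohenMacaulayRing.depthGE {d : ℕ} (hd : ringKrullDim R = d)
    (hR : IsCohenMacaulayRing R) : DepthGE d (ModuleCat.of R R) :=
  ((cm_iff hd (ModuleCat.of R R)).mp ⟨inferInstanceAs (Module.Finite R R), Or.inr hR⟩).2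

theorem isWeaklyRegular_of_retract {R : Type*} [CommRing R] {M M' : Type*} [AddCommGroup M]
    [AddCommGroup M'] [Module R M] [Module R M'] (s : M →ₗ[R] M') (p : M' →ₗ[R] M)
    (hps : p ∘ₗ s = LinearMap.id) {rs : List R} (h : IsWeaklyRegular M' rs) :
    IsWeaklyRegular M rs := by
  refine ⟨fun i hi => ?_⟩
  rw [isSMulRegular_quotient_iff_mem_of_smul_mem]
  intro x hx
  have h1 := (isSMulRegular_quotient_iff_mem_of_smul_mem _ _).mp (h.regular_mod_prev i hi) (s x)
    (by rw [← map_smul]; exact Submodule.smul_top_le_comap_smul_top _ s hx)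
  have h2 := Submodule.mem_comap.mp (Submodule.smul_top_le_comap_smul_top _ p h1)
  have h3 : p (s x) = x := LinearMap.congr_fun hps x
  rwa [h3] at h2

end Depth


/-! ### Finite injective dimension forces Ext to vanish above dim R -/

section InjectiveDimension

variable {R : Type u} [CommRing R] [IsLocalRing R] [IsNoetherianRing R]

theorem eq_maximalIdeal_of_ofList_le {d : ℕ} (hd : ringKrullDim R = d) {rs : List R}
    (hreg : IsRegular R rs) (hlen : rs.length = d) {p : Ideal R} (hp : p.IsPrime)
    (hle : Ideal.ofList rs ≤ p) : p = maximalIdeal R := by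
  have hdim := ringKrullDim_add_length_eq_ringKrullDim_of_isRegular rs hreg
  rw [hd, hlen] at hdim
  have h0 : Ring.KrullDimLE 0 (R ⧸ Ideal.ofList rs) := by
    rw [Ring.krullDimLE_iff]
    -- Cancelling `d` in `a + d = d` needs `a` finite, so the values `⊥` and `⊤` are treated apart.
    generalize ringKrullDim (R ⧸ Ideal.ofList rs) = a at hdim
    induction a with
    | bot => exact bot_le
    | coe a =>
      induction a with
      | top =>
        have h : (⊤ : ℕ∞) + d = d := by exact_mod_cast hdim
        exact absurd (h ▸ top_add (d : ℕ∞) : (d : ℕ∞) = ⊤) (ENat.natCast_ne_top d)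
      | coe a =>
        have : a + d = d := by exact_mod_cast hdim
        have : a = 0 := by omega
        subst this; simp
  obtain ⟨q, hq, hqp⟩ := Ideal.exists_minimalPrimes_le hle
  have hmax := Ideal.krullDimLE_zero_quotient_iff_forall_minimalPrimes_isMaximal.mp h0 q hq
  rw [← eq_maximalIdeal hmax]
  exact (hmax.eq_of_le hp.ne_top hqp).symm

/-- A nonzero module killed by an ideal whose only prime overideal is `𝔪` contains a copy of the
residue field. -/
theorem exists_injective_residueModule {I : Ideal R}
    (hI : ∀ p : Ideal R, p.IsPrime → I ≤ p → p = maximalIdeal R) (N : ModuleCat.{u} R)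
    [Nontrivial N] (hN : ∀ x ∈ I, ∀ n : N, x • n = 0) :
    ∃ j : residueModule R →ₗ[R] N, Function.Injective j := by
  obtain ⟨p, hp⟩ := associatedPrimes.nonempty R N
  obtain ⟨hprime, s, hs⟩ := isAssociatedPrime_iff.mp (AssociatedPrimes.mem_iff.mp hp)
  have hmem (r : R) : r ∈ p ↔ r • s = 0 := by
    rw [hs, Submodule.mem_colon_singleton, Submodule.mem_bot]
  have hpm := hI p hprime fun x hx => (hmem x).mpr (hN x hx s)
  have hker : maximalIdeal R = LinearMap.ker (LinearMap.toSpanSingleton R N s) := by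
    ext r; rw [← hpm, hmem, LinearMap.mem_ker, LinearMap.toSpanSingleton_apply]
  exact ⟨Submodule.liftQ _ (LinearMap.toSpanSingleton R N s) hker.le,
    LinearMap.ker_eq_bot.mp (Submodule.ker_liftQ_eq_bot _ _ _ hker.ge)⟩

/-- The residue field embeds in `B = R/(rs)`, whose projective dimension is the length of `rs`. So
Ext^r(k, Y) is squeezed between Ext^r(B, Y) = 0 and Ext^{r+1}(B/k, Y) = 0. -/
theorem subsingleton_ext_residueModule_of_forall_succ {rs : List R} (hreg : IsRegular R rs)
    (hmax : ∀ p : Ideal R, p.IsPrime → Ideal.ofList rs ≤ p → p = maximalIdeal R)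
    {Y : ModuleCat.{u} R} {r : ℕ} (hr : rs.length < r)
    (h : ∀ N : ModuleCat.{u} R, Module.Finite R N → Subsingleton (Ext N Y (r + 1))) :
    Subsingleton (Ext (residueModule R) Y r) := by
  -- The `Shrink` only matches the form of `ModuleCat.projectiveDimension_quotient_eq_length`.
  let B : ModuleCat.{u} R := ModuleCat.of R (Shrink.{u} (R ⧸ Ideal.ofList rs))
  let e : B ≃ₗ[R] R ⧸ Ideal.ofList rs := Shrink.linearEquiv R _
  have hpd : HasProjectiveDimensionLE B rs.length := by
    rw [← projectiveDimension_le_iff]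
    exact (ModuleCat.projectiveDimension_quotient_eq_length rs hreg).le
  have hne : Ideal.ofList rs ≠ ⊤ := fun h => hreg.top_ne_smul (by rw [h]; simp)
  have : Nontrivial (R ⧸ Ideal.ofList rs) := Ideal.Quotient.nontrivial_iff.mpr hne
  have : Nontrivial B := e.toEquiv.nontrivial
  have : Module.Finite R B := Module.Finite.equiv e.symm
  obtain ⟨j, hj⟩ := exists_injective_residueModule hmax B fun x hx n => e.injective (by
    rw [map_smul, map_zero]
    obtain ⟨y, hy⟩ := Ideal.Quotient.mk_surjective (e n)
    rw [← hy, ← Ideal.Quotient.mkₐ_eq_mk R, ← map_smul, Ideal.Quotient.mkₐ_eq_mk,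
      Ideal.Quotient.eq_zero_iff_mem]
    exact Ideal.mul_mem_right _ _ hx)
  exact subsingleton_ext_left_left (C := ModuleCat.of R (B ⧸ LinearMap.range j)) hj
    (LinearMap.exact_map_mkQ_range j) (Submodule.mkQ_surjective _) Y
    (HasProjectiveDimensionLT.subsingleton B (rs.length + 1) r hr Y) (h _ inferInstance)

/-- By prime filtrations it is enough to treat `R/p`. For `p = 𝔪` this is the hypothesis on the
residue field; otherwise some `x ∈ 𝔪 \ p` is regular on `R/p`, and vanishing one degree higher on
the quotient by `x` suffices by Nakayama. -/
theorem subsingleton_ext_of_forall_succ {Y : ModuleCat.{u} R} [Module.Finite R Y] {r : ℕ}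
    (hk : Subsingleton (Ext (residueModule R) Y r))
    (h : ∀ N : ModuleCat.{u} R, Module.Finite R N → Subsingleton (Ext N Y (r + 1)))
    (N : ModuleCat.{u} R) (hN : Module.Finite R N) : Subsingleton (Ext N Y r) := by
  suffices H : ∀ (N : Type u) [AddCommGroup N] [Module R N], Module.Finite R N →
      Subsingleton (Ext (ModuleCat.of R N) Y r) from H N hN
  clear hN N
  intro N _ _ hN
  induction hN using IsNoetherianRing.induction_on_isQuotientEquivQuotientPrime R with
  | subsingleton N => exact subsingleton_ext_of_subsingleton_left (N := ModuleCat.of R N) Y r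
  | exact A B C f g hf hg hfg hA hC =>
    exact subsingleton_ext_middle_left (A := ModuleCat.of R A) (B := ModuleCat.of R B)
      (C := ModuleCat.of R C) hf hfg hg Y hA hC
  | quotient N p e =>
    by_cases hp : p.asIdeal = maximalIdeal R
    · have e' : N ≃ₗ[R] ResidueField R := e.trans (Submodule.quotEquivOfEq _ _ hp)
      -- Invariance under the isomorphism `e'`, read off from the exact sequence 0 → N → k → 0 → 0.
      exact subsingleton_ext_left_left (A := ModuleCat.of R N) (B := residueModule R)
        (C := ModuleCat.of R PUnit.{u + 1}) (f := e'.toLinearMap) (g := 0) e'.injective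
        ((e'.toLinearMap.exact_zero_iff_surjective _).mpr e'.surjective)
        (fun _ => ⟨0, Subsingleton.elim _ _⟩) Y hk
        (h (ModuleCat.of R PUnit.{u + 1}) (inferInstanceAs (Module.Finite R PUnit.{u + 1})))
    · obtain ⟨x, hxm, hxp⟩ := Set.exists_of_ssubset
        (lt_of_le_of_ne (le_maximalIdeal p.2.ne_top) hp : p.asIdeal < maximalIdeal R)
      have hreg : IsSMulRegular (ModuleCat.of R N) x := by
        refine (LinearEquiv.isSMulRegular_congr e x).mpr ?_
        refine (isSMulRegular_quotient_iff_mem_of_smul_mem _ _).mpr fun y hy => ?_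
        exact (p.2.mem_or_mem hy).resolve_left hxp
      exact subsingleton_ext_of_quotSMulTop (N := ModuleCat.of R N) hxm hreg
        (h _ (inferInstanceAs (Module.Finite R (QuotSMulTop x N))))

/-- Over a Cohen-Macaulay local ring of dimension `d`, a finitely generated module `Y` of finite
injective dimension has `Ext^i(N, Y) = 0` for `i > d` and `N` finitely generated. -/
theorem subsingleton_ext_of_finite_injectiveDimension {rs : List R} (hreg : IsRegular R rs)
    (hmax : ∀ p : Ideal R, p.IsPrime → Ideal.ofList rs ≤ p → p = maximalIdeal R)
    {Y : ModuleCat.{u} R} [Module.Finite R Y] {n : ℕ} (hY : HasInjectiveDimensionLE Y n)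
    {i : ℕ} (hi : rs.length < i) (N : ModuleCat.{u} R) (hN : Module.Finite R N) :
    Subsingleton (Ext N Y i) := by
  -- Descending induction on `i`, starting above the injective dimension `n`; `k` bounds the number
  -- of steps down.
  suffices H : ∀ k i, rs.length < i → n < i + k → ∀ N : ModuleCat.{u} R, Module.Finite R N →
      Subsingleton (Ext N Y i) from H (n + 1) i hi (by omega) N hN
  intro k
  induction k with
  | zero => exact fun i _ hi N _ => HasInjectiveDimensionLT.subsingleton Y (n + 1) i hi N
  | succ k ih =>
    intro i hi hk
    have h := ih (i + 1) (by omega) (by omega)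
    exact subsingleton_ext_of_forall_succ
      (subsingleton_ext_residueModule_of_forall_succ hreg hmax hi h) h

/-- Each regular element lowers the vanishing bound by one. A sequence of length `d` on a maximal
Cohen–Macaulay module thus kills every positive degree. -/
theorem subsingleton_ext_of_isWeaklyRegular {Y : ModuleCat.{u} R} [Module.Finite R Y] {d : ℕ}
    (hY : ∀ i, d < i → ∀ N : ModuleCat.{u} R, Module.Finite R N → Subsingleton (Ext N Y i))
    {rs : List R} (hmem : ∀ r ∈ rs, r ∈ maximalIdeal R) (N : ModuleCat.{u} R)
    [hN : Module.Finite R N] (hreg : IsWeaklyRegular N rs) {i : ℕ} (hi : d < i + rs.length) :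
    Subsingleton (Ext N Y i) := by
  induction rs generalizing N i with
  | nil => exact hY i (by simpa using hi) N hN
  | cons x rs ih =>
    obtain ⟨hx, hrs⟩ := (isWeaklyRegular_cons_iff _ _ _).mp hreg
    exact subsingleton_ext_of_quotSMulTop (hmem x (by simp)) hx
      (ih (fun r hr => hmem r (by simp [hr])) (ModuleCat.of R (QuotSMulTop x N)) hrs
        (by simp only [List.length_cons] at hi; omega))

end InjectiveDimension

/-! ### Change of rings along a regular sequence, and Nakayama for maps -/

section Reduction

variable {R : Type u} [CommRing R]

/-- Presenting `W/(rs)W` as any surjection `q : W → Q` with the right kernel lets inductions on `rs`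
replace `W` by `W/xW` while the target `Q` stays fixed. -/
theorem ofList_smul_top_quotSMulTop_eq_ker {W Q : Type*} [AddCommGroup W] [Module R W]
    [AddCommGroup Q] [Module R Q] {x : R} {rs : List R} {q : W →ₗ[R] Q}
    (hker : LinearMap.ker q = Ideal.ofList (x :: rs) • ⊤) :
    ∃ q' : QuotSMulTop x W →ₗ[R] Q, q' ∘ₗ Submodule.mkQ _ = q ∧
      LinearMap.ker q' = Ideal.ofList rs • ⊤ := by
  have hle : x • (⊤ : Submodule R W) ≤ LinearMap.ker q := by
    rw [hker, Ideal.ofList_cons_smul]; exact le_sup_left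
  refine ⟨Submodule.liftQ _ q hle, Submodule.liftQ_mkQ _ _ _, ?_⟩
  rw [Submodule.ker_liftQ, hker, Ideal.ofList_cons_smul, Submodule.map_sup, Submodule.map_smul'',
    Submodule.map_top, Submodule.range_mkQ]
  rw [sup_eq_right, Submodule.map_le_iff_le_comap]
  exact fun w hw => by
    rw [Submodule.mem_comap, Submodule.mkQ_apply, (Submodule.Quotient.mk_eq_zero _).mpr hw]
    exact Submodule.zero_mem _

variable {W M Q : ModuleCat.{u} R}

theorem exists_lift_of_subsingleton_ext_one {A B C : ModuleCat.{u} R} {f : A →ₗ[R] B}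
    {g : B →ₗ[R] C} (hf : Function.Injective f) (hfg : Function.Exact f g)
    (hg : Function.Surjective g) (hext : Subsingleton (Ext M A 1)) (h : M →ₗ[R] C) :
    ∃ h' : M →ₗ[R] B, g ∘ₗ h' = h := by
  obtain ⟨w, hS⟩ := shortExact_ofHom hf hfg hg
  obtain ⟨b, hb⟩ := Ext.covariant_sequence_exact₃ M hS (Ext.mk₀ (ModuleCat.ofHom h)) rfl
    (hext.elim _ _)
  obtain ⟨b, rfl⟩ := (Ext.mk₀_bijective M B).2 b
  rw [Ext.mk₀_comp_mk₀] at hb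
  exact ⟨b.hom, congrArg ModuleCat.Hom.hom ((Ext.mk₀_bijective _ _).1 hb)⟩

theorem exact_lsmul_mkQ (W : Type*) [AddCommGroup W] [Module R W] (x : R) :
    Function.Exact (LinearMap.lsmul R W x) (Submodule.mkQ (x • (⊤ : Submodule R W))) :=
  LinearMap.exact_lsmul_mkQ_smul_top W x

theorem subsingleton_ext_quotSMulTop {x : R} (hx : IsSMulRegular W x) {i : ℕ}
    (h₀ : Subsingleton (Ext M W i)) (h₁ : Subsingleton (Ext M W (i + 1))) :
    Subsingleton (Ext M (ModuleCat.of R (QuotSMulTop x W)) i) :=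
  subsingleton_ext_right_right (A := W) (B := W) (C := ModuleCat.of R (QuotSMulTop x W))
    (f := LinearMap.lsmul R W x) (g := Submodule.mkQ (x • (⊤ : Submodule R W)))
    hx (exact_lsmul_mkQ W x) (Submodule.mkQ_surjective _) M h₀ h₁

theorem bijective_of_ker_eq_ofList_nil {q : W →ₗ[R] Q} (hq : Function.Surjective q)
    (hker : LinearMap.ker q = Ideal.ofList ([] : List R) • ⊤) : Function.Bijective q :=
  ⟨LinearMap.ker_eq_bot.mp (by rw [hker, Ideal.ofList_nil, Submodule.bot_smul]), hq⟩

/-- If `Ext^i(M, W) = 0` for `i > 0`, homomorphisms from `M` to `W/(rs)W` lift to `W`. -/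
theorem exists_lift_of_subsingleton_ext {rs : List R} (hreg : IsWeaklyRegular W rs)
    (hext : ∀ i, Subsingleton (Ext M W (i + 1))) {q : W →ₗ[R] Q} (hq : Function.Surjective q)
    (hker : LinearMap.ker q = Ideal.ofList rs • ⊤) (g : M →ₗ[R] Q) :
    ∃ h : M →ₗ[R] W, q ∘ₗ h = g := by
  induction rs generalizing W with
  | nil =>
    let e := LinearEquiv.ofBijective q (bijective_of_ker_eq_ofList_nil hq hker)
    exact ⟨e.symm.toLinearMap ∘ₗ g, by ext m; exact e.apply_symm_apply (g m)⟩
  | cons x rs ih =>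
    obtain ⟨hx, hrs⟩ := (isWeaklyRegular_cons_iff _ _ _).mp hreg
    obtain ⟨q', hq', hker'⟩ := ofList_smul_top_quotSMulTop_eq_ker hker
    have hsurj : Function.Surjective q' :=
      Function.Surjective.of_comp (g := Submodule.mkQ (x • (⊤ : Submodule R W)))
        (by rw [← LinearMap.coe_comp, hq']; exact hq)
    obtain ⟨h', hh'⟩ := ih (W := ModuleCat.of R (QuotSMulTop x W)) hrs
      (fun i => subsingleton_ext_quotSMulTop hx (hext i) (hext (i + 1))) hsurj hker'
    obtain ⟨h, hh⟩ := exists_lift_of_subsingleton_ext_one (A := W) (B := W)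
      (C := ModuleCat.of R (QuotSMulTop x W)) (f := LinearMap.lsmul R W x)
      (g := Submodule.mkQ (x • (⊤ : Submodule R W))) hx (exact_lsmul_mkQ W x)
      (Submodule.mkQ_surjective _) (hext 0) h'
    exact ⟨h, by rw [← hh', ← hq', LinearMap.comp_assoc, hh]⟩

/-- If `rs` is regular on `W` and kills `A` and `N`, then `Hom(-, W/(rs)W)` behaves on `A → N` like
`Ext^n(-, W)`, where `n` is the length of `rs`. -/
theorem exists_extension_of_ext_surjective {A N : ModuleCat.{u} R} {u : A →ₗ[R] N} {rs : List R}
    (hreg : IsWeaklyRegular W rs) (hN : ∀ x ∈ rs, ∀ n : N, x • n = 0)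
    (hA : ∀ i < rs.length, Subsingleton (Ext A W i))
    (hsurj : ∀ e : Ext A W rs.length, ∃ e' : Ext N W rs.length,
      (Ext.mk₀ (ModuleCat.ofHom u)).comp e' (zero_add _) = e)
    {q : W →ₗ[R] Q} (hq : Function.Surjective q)
    (hker : LinearMap.ker q = Ideal.ofList rs • ⊤) (φ : A →ₗ[R] Q) :
    ∃ ψ : N →ₗ[R] Q, ψ ∘ₗ u = φ := by
  induction rs generalizing W with
  | nil =>
    let e := LinearEquiv.ofBijective q (bijective_of_ker_eq_ofList_nil hq hker)
    obtain ⟨e', he'⟩ := hsurj (Ext.mk₀ (ModuleCat.ofHom (e.symm.toLinearMap ∘ₗ φ)))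
    obtain ⟨ψ, rfl⟩ := (Ext.mk₀_bijective N W).2 e'
    have h1 := Ext.mk₀_comp_mk₀ (ModuleCat.ofHom u) ψ
    have h2 := congrArg ModuleCat.Hom.hom ((Ext.mk₀_bijective _ _).1 (h1.symm.trans he'))
    refine ⟨q ∘ₗ ψ.hom, ?_⟩
    ext a
    have h3 : ψ.hom (u a) = e.symm (φ a) := LinearMap.congr_fun h2 a
    change e (ψ.hom (u a)) = φ a
    rw [h3, e.apply_symm_apply]
  | cons x rs ih =>
    obtain ⟨hx, hrs⟩ := (isWeaklyRegular_cons_iff _ _ _).mp hreg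
    obtain ⟨q', hq', hker'⟩ := ofList_smul_top_quotSMulTop_eq_ker hker
    have hsurj' : Function.Surjective q' :=
      Function.Surjective.of_comp (g := Submodule.mkQ (x • (⊤ : Submodule R W)))
        (by rw [← LinearMap.coe_comp, hq']; exact hq)
    refine ih (W := ModuleCat.of R (QuotSMulTop x W)) hrs (fun y hy => hN y (by simp [hy]))
      (fun i hi => subsingleton_ext_quotSMulTop hx (hA i (by simp; omega))
        (hA (i + 1) (by simp; omega))) ?_ hsurj' hker'
    intro e
    obtain ⟨w, hS⟩ := shortExact_ofHom (A := W) (B := W)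
      (C := ModuleCat.of R (QuotSMulTop x W)) (f := LinearMap.lsmul R W x)
      (g := Submodule.mkQ (x • (⊤ : Submodule R W))) hx (exact_lsmul_mkQ W x)
      (Submodule.mkQ_surjective _)
    -- The class `e` is pushed by the connecting map into Ext(A, W) one degree higher, where it
    -- extends to `N`. Since `x` kills `N` it kills the extension `ε`, which therefore comes back
    -- from a class `ε'` with values in `W/xW`.
    obtain ⟨ε, hε⟩ := hsurj (e.comp hS.extClass rfl)
    have hxε : ε.comp (Ext.mk₀ (ModuleCat.ofHom (LinearMap.lsmul R W x))) (add_zero _) = 0 :=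
      (ext_comp_mk₀_smul_id ε x).trans (smul_ext_eq_zero ε (hN x (by simp)))
    obtain ⟨ε', hε'⟩ := Ext.covariant_sequence_exact₁ N hS ε hxε rfl
    refine ⟨ε', ?_⟩
    -- The restriction of `ε'` and `e` agree after the connecting map, which is injective on this
    -- group because Ext(A, W) vanishes in degree `rs.length`.
    have hzero : ((Ext.mk₀ (ModuleCat.ofHom u)).comp ε' (zero_add _) - e).comp hS.extClass rfl
        = 0 := by
      rw [sub_eq_add_neg, Ext.add_comp, Ext.neg_comp, ← hε, ← hε', ← sub_eq_add_neg, sub_eq_zero]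
      exact Ext.comp_assoc _ _ _ _ _ (by omega)
    obtain ⟨b, hb⟩ := Ext.covariant_sequence_exact₃ A hS _ rfl hzero
    rw [(hA rs.length (by simp)).elim b 0, Ext.zero_comp] at hb
    exact sub_eq_zero.mp hb.symm

/-- One half of the isomorphism Ext^n(A, W) ≅ Hom(A, W/(rs)W): as `x` kills Ext(A, W), each class is
the image of one with values in `W/xW` under the connecting map. -/
theorem subsingleton_ext_of_forall_hom_eq_zero {A : ModuleCat.{u} R} {rs : List R}
    (hreg : IsWeaklyRegular W rs) (hA : ∀ x ∈ rs, ∀ a : A, x • a = 0)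
    {q : W →ₗ[R] Q} (hq : Function.Surjective q)
    (hker : LinearMap.ker q = Ideal.ofList rs • ⊤) (h : ∀ φ : A →ₗ[R] Q, φ = 0) :
    Subsingleton (Ext A W rs.length) := by
  induction rs generalizing W with
  | nil =>
    refine subsingleton_of_forall_eq 0 fun e => ?_
    obtain ⟨φ, rfl⟩ := (Ext.mk₀_bijective A W).2 e
    have : φ = 0 := by
      ext a
      exact (bijective_of_ker_eq_ofList_nil hq hker).1
        ((LinearMap.congr_fun (h (q ∘ₗ φ.hom)) a).trans (map_zero q).symm)
    rw [this, Ext.mk₀_zero]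
  | cons x rs ih =>
    obtain ⟨hx, hrs⟩ := (isWeaklyRegular_cons_iff _ _ _).mp hreg
    obtain ⟨q', hq', hker'⟩ := ofList_smul_top_quotSMulTop_eq_ker hker
    have hsurj' : Function.Surjective q' :=
      Function.Surjective.of_comp (g := Submodule.mkQ (x • (⊤ : Submodule R W)))
        (by rw [← LinearMap.coe_comp, hq']; exact hq)
    have hsub := ih (W := ModuleCat.of R (QuotSMulTop x W)) hrs (fun y hy => hA y (by simp [hy]))
      hsurj' hker'
    obtain ⟨w, hS⟩ := shortExact_ofHom (A := W) (B := W)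
      (C := ModuleCat.of R (QuotSMulTop x W)) (f := LinearMap.lsmul R W x)
      (g := Submodule.mkQ (x • (⊤ : Submodule R W))) hx (exact_lsmul_mkQ W x)
      (Submodule.mkQ_surjective _)
    refine subsingleton_of_forall_eq 0 fun e => ?_
    have hxe : e.comp (Ext.mk₀ (ModuleCat.ofHom (LinearMap.lsmul R W x))) (add_zero _) = 0 :=
      (ext_comp_mk₀_smul_id e x).trans (smul_ext_eq_zero e (hA x (by simp)))
    obtain ⟨e', he'⟩ := Ext.covariant_sequence_exact₁ A hS e hxe rfl
    rw [← he', hsub.elim e' 0, Ext.zero_comp]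

/-- The hypothesis says that `F` is injective modulo `(rs)`; it is lifted one element at a time.
Injectivity modulo `x` gives `ker F = x ker F`, so the kernel vanishes by Nakayama, and it also
makes `x` regular on the cokernel. -/
theorem injective_of_comap_smul_top_le [IsLocalRing R] [IsNoetherianRing R] {M W : Type u}
    [AddCommGroup M] [Module R M] [Module.Finite R M] [AddCommGroup W] [Module R W]
    {rs : List R} (hmem : ∀ r ∈ rs, r ∈ maximalIdeal R) (hM : IsWeaklyRegular M rs)
    (hW : IsWeaklyRegular W rs) (F : M →ₗ[R] W)
    (h : (Ideal.ofList rs • ⊤ : Submodule R W).comap F ≤ Ideal.ofList rs • ⊤) :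
    Function.Injective F ∧ IsWeaklyRegular (W ⧸ LinearMap.range F) rs := by
  induction rs generalizing M W with
  | nil =>
    refine ⟨LinearMap.ker_eq_bot.mp (le_bot_iff.mp ?_), IsWeaklyRegular.nil R _⟩
    simpa using h
  | cons x rs ih =>
    obtain ⟨hxM, hrsM⟩ := (isWeaklyRegular_cons_iff _ _ _).mp hM
    obtain ⟨hxW, hrsW⟩ := (isWeaklyRegular_cons_iff _ _ _).mp hW
    let F' : QuotSMulTop x M →ₗ[R] QuotSMulTop x W := QuotSMulTop.map x F
    have hcomapQ (V : Type u) [AddCommGroup V] [Module R V] :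
        (Ideal.ofList rs • (⊤ : Submodule R (QuotSMulTop x V))).comap (Submodule.mkQ _) =
          Ideal.ofList (x :: rs) • ⊤ := by
      obtain ⟨q', hq', hker'⟩ := ofList_smul_top_quotSMulTop_eq_ker (W := V)
        (q := Submodule.mkQ (Ideal.ofList (x :: rs) • (⊤ : Submodule R V)))
        (Submodule.ker_mkQ _)
      rw [← hker', ← LinearMap.ker_comp, hq', Submodule.ker_mkQ]
    have h' : (Ideal.ofList rs • ⊤ : Submodule R (QuotSMulTop x W)).comap F' ≤
        Ideal.ofList rs • ⊤ := by
      intro m hm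
      obtain ⟨m, rfl⟩ := Submodule.mkQ_surjective _ m
      rw [← Submodule.mem_comap, hcomapQ M]
      refine h ?_
      rw [← hcomapQ W]
      exact hm
    obtain ⟨hinj, hreg⟩ := ih (fun r hr => hmem r (by simp [hr])) hrsM hrsW F' h'
    have hdiv {m : M} {w : W} (hm : F m = x • w) : ∃ m', m = x • m' := by
      have h0 : F' (Submodule.Quotient.mk m) = 0 := by
        change Submodule.Quotient.mk (F m) = 0
        rw [hm, Submodule.Quotient.mk_eq_zero]
        exact Submodule.smul_mem_pointwise_smul _ _ _ trivial
      have h1 := hinj (h0.trans (map_zero F').symm)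
      rw [Submodule.Quotient.mk_eq_zero, Submodule.mem_smul_pointwise_iff_exists] at h1
      obtain ⟨m', -, hm'⟩ := h1
      exact ⟨m', hm'.symm⟩
    refine ⟨?_, ?_⟩
    · have hsub : Subsingleton (LinearMap.ker F) := by
        refine subsingleton_of_forall_exists_smul (hmem x (by simp)) fun m => ?_
        obtain ⟨m', hm'⟩ := hdiv (m := m) (w := 0) (by rw [smul_zero]; exact m.2)
        refine ⟨⟨m', hxW ?_⟩, Subtype.ext hm'.symm⟩
        change x • F m' = x • 0
        rw [← map_smul, ← hm', smul_zero]
        exact m.2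
      exact LinearMap.ker_eq_bot.mp (Submodule.subsingleton_iff_eq_bot.mp hsub)
    · refine IsWeaklyRegular.cons ?_ ?_
      · rw [isSMulRegular_quotient_iff_mem_of_smul_mem]
        rintro w ⟨m, hm⟩
        obtain ⟨m', rfl⟩ := hdiv hm
        rw [map_smul] at hm
        exact ⟨m', hxW hm⟩
      · have hrange : LinearMap.range F' =
            (LinearMap.range F).map (Submodule.mkQ (x • (⊤ : Submodule R W))) := by
          have h1 : F' ∘ₗ Submodule.mkQ (x • (⊤ : Submodule R M)) =
              Submodule.mkQ (x • (⊤ : Submodule R W)) ∘ₗ F := by ext m; rfl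
          rw [← LinearMap.range_comp_of_range_eq_top F'
            (Submodule.range_mkQ (x • (⊤ : Submodule R M))), h1]
          exact LinearMap.range_comp _ _
        let S : Submodule R W := x • ⊤
        let T : Submodule R W := LinearMap.range F
        have hS : S.map T.mkQ = x • (⊤ : Submodule R (W ⧸ T)) := by
          rw [Submodule.map_pointwise_smul, Submodule.map_top, Submodule.range_mkQ]
        -- Both sides are `W/(xW + F(M))`.
        have e : (QuotSMulTop x W ⧸ LinearMap.range F') ≃ₗ[R]
            QuotSMulTop x (W ⧸ LinearMap.range F) :=
          Submodule.quotEquivOfEq _ _ hrange ≪≫ₗ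
            Submodule.quotientQuotientEquivQuotientSup S T ≪≫ₗ
            Submodule.quotEquivOfEq _ _ (sup_comm S T) ≪≫ₗ
            (Submodule.quotientQuotientEquivQuotientSup T S).symm ≪≫ₗ
            Submodule.quotEquivOfEq _ _ hS
        exact (e.isWeaklyRegular_congr rs).mp hreg

end Reduction


theorem isWeaklyRegular_pi {R W : Type*} [CommRing R] [AddCommGroup W] [Module R W] (n : ℕ)
    {rs : List R} (h : IsWeaklyRegular W rs) : IsWeaklyRegular (Fin n → W) rs := by
  refine ⟨fun i hi => ?_⟩
  rw [isSMulRegular_quotient_iff_mem_of_smul_mem]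
  intro w hw
  rw [← Finset.univ_sum_single w]
  refine Submodule.sum_mem _ fun j _ => ?_
  refine Submodule.smul_top_le_comap_smul_top _ (LinearMap.single R (fun _ : Fin n => W) j) ?_
  refine (isSMulRegular_quotient_iff_mem_of_smul_mem _ _).mp (h.regular_mod_prev i hi) _ ?_
  exact Submodule.smul_top_le_comap_smul_top _ (LinearMap.proj (φ := fun _ : Fin n => W) j) hw

/-! ### Embedding maximal Cohen–Macaulay modules into sums of copies of ω -/

section Embedding

variable {R : Type u} [CommRing R]

theorem ext_precomp_surjective_of_injective {A N Y : ModuleCat.{u} R} {u : A →ₗ[R] N}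
    (hu : Function.Injective u) {i : ℕ}
    (h : Subsingleton (Ext (ModuleCat.of R (N ⧸ LinearMap.range u)) Y (i + 1))) (e : Ext A Y i) :
    ∃ e' : Ext N Y i, (Ext.mk₀ (ModuleCat.ofHom u)).comp e' (zero_add _) = e := by
  obtain ⟨w, hS⟩ := shortExact_ofHom (C := ModuleCat.of R (N ⧸ LinearMap.range u)) hu
    (LinearMap.exact_map_mkQ_range u) (Submodule.mkQ_surjective _)
  exact Ext.contravariant_sequence_exact₁ hS Y e (add_comm 1 i) (h.elim _ _)

variable [IsLocalRing R] [IsNoetherianRing R]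

/-- Over a Cohen-Macaulay local ring with canonical module `ω`, every maximal Cohen-Macaulay module
embeds into a finite direct sum of copies of `ω` with maximal Cohen-Macaulay cokernel. -/
theorem exists_embedding_pi {d : ℕ} (hd : ringKrullDim R = d) (hR : IsCohenMacaulayRing R)
    {ω : ModuleCat.{u} R} (hω : IsCanonicalModule ω) {M : ModuleCat.{u} R} (hM : CM R M) :
    ∃ (n : ℕ) (F : M →ₗ[R] (Fin n → ω)), Function.Injective F ∧
      CM R (ModuleCat.of R ((Fin n → ω) ⧸ LinearMap.range F)) := by
  obtain ⟨_, hMd⟩ := (cm_iff hd M).mp hM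
  obtain ⟨_, hωd⟩ := (cm_iff hd ω).mp hω.maximal_cohenMacaulay
  -- Of the type-one condition, only the nonvanishing of Ext^d(k, ω) matters for the embedding.
  have hext_ne : ¬ Subsingleton (Ext (residueModule R) ω d) := by
    obtain ⟨d', hd', ⟨e⟩⟩ := hω.type_one
    obtain rfl : d' = d := by exact_mod_cast hd'.trans hd
    exact fun h => not_subsingleton (ResidueField R) (e.symm.toEquiv.subsingleton)
  -- a common regular sequence on `R`, `M` and `ω`
  let P : ModuleCat.{u} R := ModuleCat.of R (R × (ModuleCat.of R (M × ω)))
  have hP : DepthGE d P := DepthGE.prod (IsCohenMacaulayRing.depthGE hd hR) (DepthGE.prod hMd hωd)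
  have : Module.Finite R P := inferInstanceAs (Module.Finite R (R × (M × ω)))
  have : Nontrivial P := inferInstanceAs (Nontrivial (R × (M × ω)))
  obtain ⟨rs, hlen, hmem, hreg⟩ := hP.exists_isRegular
  have hregR : IsRegular R rs := .of_isWeaklyRegular_of_mem_maximalIdeal R hmem
    (isWeaklyRegular_of_retract (M' := P) (LinearMap.inl R R (M × ω)) (LinearMap.fst R R (M × ω))
      (by ext; rfl) hreg.toIsWeaklyRegular)
  have hregMω : IsWeaklyRegular (M × ω) rs :=
    isWeaklyRegular_of_retract (M' := P) (LinearMap.inr R R (M × ω)) (LinearMap.snd R R (M × ω))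
      (by ext <;> rfl) hreg.toIsWeaklyRegular
  have hregM : IsWeaklyRegular M rs :=
    isWeaklyRegular_of_retract (LinearMap.inl R M ω) (LinearMap.fst R M ω) (by ext; rfl) hregMω
  have hregω : IsWeaklyRegular ω rs :=
    isWeaklyRegular_of_retract (LinearMap.inr R M ω) (LinearMap.snd R M ω) (by ext; rfl) hregMω
  have hmax (p : Ideal R) (hp : p.IsPrime) (hle : Ideal.ofList rs ≤ p) : p = maximalIdeal R :=
    eq_maximalIdeal_of_ofList_le hd hregR hlen hp hle
  -- vanishing of `Ext`
  obtain ⟨n, hn⟩ := hω.finite_injectiveDimension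
  have hvan (i : ℕ) (hi : d < i) (N : ModuleCat.{u} R) (hN : Module.Finite R N) :
      Subsingleton (Ext N ω i) :=
    subsingleton_ext_of_finite_injectiveDimension hregR hmax hn (hlen ▸ hi) N hN
  have hvanM (i : ℕ) : Subsingleton (Ext M ω (i + 1)) :=
    subsingleton_ext_of_isWeaklyRegular hvan hmem M hregM (by omega)
  -- homomorphisms to `ω / (rs) ω` detect the elements of `M / (rs) M`
  let J : Ideal R := Ideal.ofList rs
  have hJm : J ≤ maximalIdeal R := Ideal.span_le.mpr hmem
  have hrsJ {x : R} (hx : x ∈ rs) : x ∈ J := Ideal.subset_span hx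
  let Q : ModuleCat.{u} R := ModuleCat.of R (ω ⧸ (J • ⊤ : Submodule R ω))
  let q : ω →ₗ[R] Q := Submodule.mkQ _
  have hq : Function.Surjective q := Submodule.mkQ_surjective _
  have hker : LinearMap.ker q = Ideal.ofList rs • ⊤ := Submodule.ker_mkQ _
  let N : ModuleCat.{u} R := ModuleCat.of R (M ⧸ (J • ⊤ : Submodule R M))
  have hNJ (x : R) (hx : x ∈ J) (n : N) : x • n = 0 := by
    obtain ⟨m, rfl⟩ := Submodule.mkQ_surjective _ n
    rw [← map_smul]
    exact (Submodule.Quotient.mk_eq_zero _).mpr (Submodule.smul_mem_smul hx trivial)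
  have hkJ (x : R) (hx : x ∈ J) (a : residueModule R) : x • a = 0 := by
    obtain ⟨r, rfl⟩ := residue_surjective a
    change x • residue R r = 0
    rw [Algebra.smul_def, ResidueField.algebraMap_eq, (residue_eq_zero_iff x).mpr (hJm hx),
      zero_mul]
  -- `K` collects the elements of `M/JM` that no map to `ω/Jω` detects. If it were nonzero it would
  -- contain a copy of k; every map k → `Q` extends to `N`, hence vanishes on k ⊆ `K`, which would
  -- force Ext^d(k, ω) = 0.
  let K : Submodule R N := ⨅ g : N →ₗ[R] Q, LinearMap.ker g
  have hK : Subsingleton K := by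
    by_contra hK
    rw [not_subsingleton_iff_nontrivial] at hK
    obtain ⟨j, hj⟩ := exists_injective_residueModule hmax (ModuleCat.of R K)
      fun x hx k => Subtype.ext (hNJ x hx k)
    have hu : Function.Injective (K.subtype ∘ₗ j) := K.injective_subtype.comp hj
    refine hext_ne (hlen ▸ subsingleton_ext_of_forall_hom_eq_zero hregω
      (fun x hx => hkJ x (hrsJ hx)) hq hker fun φ => ?_)
    obtain ⟨ψ, rfl⟩ := exists_extension_of_ext_surjective (N := N) hregω
      (fun x hx => hNJ x (hrsJ hx)) (fun i hi => hωd i (hlen ▸ hi))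
      (ext_precomp_surjective_of_injective hu (hvan _ (by omega) _ inferInstance)) hq hker φ
    ext a
    exact (Submodule.mem_iInf _).mp (j a).2 ψ
  obtain ⟨n, b, hb⟩ := Module.Finite.exists_fin (R := R) (M := M →ₗ[R] ω)
  let F : M →ₗ[R] (Fin n → ω) := LinearMap.pi b
  have hpi : IsWeaklyRegular (Fin n → ω) rs := isWeaklyRegular_pi n hregω
  obtain ⟨hinj, hcoker⟩ := injective_of_comap_smul_top_le hmem hregM hpi F fun m hm => by
    have hb' (i : Fin n) : b i m ∈ (J • ⊤ : Submodule R ω) :=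
      Submodule.smul_top_le_comap_smul_top J (LinearMap.proj i) hm
    have hall (h : M →ₗ[R] ω) : h m ∈ (J • ⊤ : Submodule R ω) := by
      have hle : Submodule.span R (Set.range b) ≤
          (J • ⊤ : Submodule R ω).comap (LinearMap.applyₗ m) := by
        rw [Submodule.span_le]
        rintro _ ⟨i, rfl⟩
        exact hb' i
      exact hle (hb ▸ Submodule.mem_top)
    have hmK : (Submodule.Quotient.mk m : N) ∈ K := by
      refine (Submodule.mem_iInf _).mpr fun g => ?_
      obtain ⟨h, hh⟩ := exists_lift_of_subsingleton_ext hregω hvanM hq hker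
        (g ∘ₗ Submodule.mkQ (J • ⊤ : Submodule R M))
      rw [LinearMap.mem_ker, ← Submodule.mkQ_apply, ← LinearMap.comp_apply, ← hh]
      exact (Submodule.Quotient.mk_eq_zero _).mpr (hall h)
    exact (Submodule.Quotient.mk_eq_zero _).mp
      (congrArg Subtype.val (hK.elim ⟨_, hmK⟩ 0))
  refine ⟨n, F, hinj, (cm_iff hd _).mpr ⟨inferInstance, ?_⟩⟩
  exact hlen ▸ DepthGE.of_isWeaklyRegular hmem hcoker

end Embedding


/-! ### Additive closures and the balls |G|_r -/

section Additive

variable {R : Type u} [CommRing R]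

/-- Closure under finite direct sums and direct summands. -/
structure IsAdditive (Y : ObjectProperty (ModuleCat.{u} R)) : Prop where
  retract {M N : ModuleCat.{u} R} (s : M →ₗ[R] N) (p : N →ₗ[R] M) (h : p ∘ₗ s = LinearMap.id)
    (hN : Y N) : Y M
  pi {n : ℕ} (F : Fin n → ModuleCat.{u} R) (h : ∀ i, Y (F i)) :
    Y (ModuleCat.of R ((i : Fin n) → F i))

variable {X X' Y Y' : ObjectProperty (ModuleCat.{u} R)}

theorem IsAdditive.of_equiv (hY : IsAdditive Y) {M N : ModuleCat.{u} R} (e : M ≃ₗ[R] N)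
    (hN : Y N) : Y M :=
  hY.retract e.toLinearMap e.symm.toLinearMap (by ext; simp) hN

theorem IsAdditive.of_subsingleton (hY : IsAdditive Y) (M : ModuleCat.{u} R) [Subsingleton M] :
    Y M :=
  hY.retract 0 0 (by ext; exact Subsingleton.elim _ _) (hY.pi (n := 0) (fun _ => M) (by simp))

theorem IsAdditive.prod (hY : IsAdditive Y) {M N : ModuleCat.{u} R} (hM : Y M) (hN : Y N) :
    Y (ModuleCat.of R (M × N)) := by
  let F : Fin 2 → ModuleCat.{u} R := ![M, N]
  let s : M × N →ₗ[R] ((i : Fin 2) → F i) := LinearMap.pi fun i =>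
    match i with
    | 0 => LinearMap.fst R M N
    | 1 => LinearMap.snd R M N
  let p : ((i : Fin 2) → F i) →ₗ[R] M × N :=
    LinearMap.prod (LinearMap.proj (φ := fun i => F i) 0) (LinearMap.proj (φ := fun i => F i) 1)
  refine hY.retract (M := ModuleCat.of R (M × N)) s p (LinearMap.ext fun x => rfl)
    (hY.pi F fun i => ?_)
  match i with
  | 0 => exact hM
  | 1 => exact hN

theorem addClosure_of_fintype {ι : Type} [Fintype ι] (F : ι → ModuleCat.{u} R)
    (hF : ∀ i, X (F i)) {M : ModuleCat.{u} R} (s : M →ₗ[R] ((i : ι) → F i))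
    (p : ((i : ι) → F i) →ₗ[R] M) (h : p ∘ₗ s = LinearMap.id) : addClosure X M := by
  let e := (Fintype.equivFin ι).symm
  let E : ((k : Fin (Fintype.card ι)) → F (e k)) ≃ₗ[R] ((i : ι) → F i) :=
    LinearEquiv.piCongrLeft R (fun i => F i) e
  refine ⟨_, fun k => F (e k), fun k => hF _, E.symm.toLinearMap ∘ₗ s, p ∘ₗ E.toLinearMap, ?_⟩
  rw [← h]
  ext m
  simp

theorem le_addClosure : X ≤ addClosure X := fun M hM =>
  addClosure_of_fintype (ι := Unit) (fun _ => M) (fun _ => hM)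
    (LinearMap.pi fun _ => LinearMap.id) (LinearMap.proj ()) (LinearMap.ext fun _ => rfl)

variable (X) in
theorem isAdditive_addClosure : IsAdditive (addClosure X) where
  retract := by
    rintro M N s p h ⟨n, F, hF, s', p', h'⟩
    refine ⟨n, F, hF, s' ∘ₗ s, p ∘ₗ p', ?_⟩
    rw [← h]
    ext m
    exact congrArg p (LinearMap.congr_fun h' (s m))
  pi := by
    intro n F hF
    choose m G hG s p hps using hF
    refine addClosure_of_fintype (ι := Σ i : Fin n, Fin (m i)) (fun k => G k.1 k.2)
      (fun k => hG k.1 k.2)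
      (LinearMap.pi fun k => LinearMap.proj k.2 ∘ₗ s k.1 ∘ₗ LinearMap.proj k.1)
      (LinearMap.pi fun i => p i ∘ₗ LinearMap.pi fun j =>
        LinearMap.proj (φ := fun k : Σ i : Fin n, Fin (m i) => G k.1 k.2) ⟨i, j⟩) ?_
    refine LinearMap.ext fun x => funext fun i => ?_
    exact LinearMap.congr_fun (hps i) (x i)

theorem IsAdditive.addClosure_le (hY : IsAdditive Y) (h : X ≤ Y) : addClosure X ≤ Y := by
  rintro M ⟨n, F, hF, s, p, hps⟩
  exact hY.retract (N := ModuleCat.of R ((i : Fin n) → F i)) s p hps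
    (hY.pi F fun i => h _ (hF i))

theorem addClosure_mono (h : X ≤ Y) : addClosure X ≤ addClosure Y :=
  (isAdditive_addClosure Y).addClosure_le (h.trans le_addClosure)

theorem ext_mono (h : X ≤ Y) (h' : X' ≤ Y') : ext X X' ≤ ext Y Y' := by
  rintro M ⟨A, B, hA, hB, f, g, hfg⟩
  exact ⟨A, B, h _ hA, h' _ hB, f, g, hfg⟩

theorem le_ext_left (hY : IsAdditive Y) : X ≤ ext X Y := fun M hM =>
  ⟨M, ModuleCat.of R PUnit.{u + 1}, hM, hY.of_subsingleton _, LinearMap.id, 0,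
    Function.injective_id, (LinearMap.exact_zero_iff_surjective _ _).mpr Function.surjective_id,
    fun _ => ⟨0, rfl⟩⟩

theorem isAdditive_addBall (X : ObjectProperty (ModuleCat.{u} R)) (r : ℕ) :
    IsAdditive (addBall X (r + 1)) := by
  cases r with
  | zero => exact isAdditive_addClosure X
  | succ r => exact isAdditive_addClosure _

theorem addBall_le_succ (X : ObjectProperty (ModuleCat.{u} R)) (r : ℕ) :
    addBall X (r + 1) ≤ addBall X (r + 2) :=
  le_addClosure.trans ((le_ext_left (isAdditive_addClosure X)).trans le_addClosure)

theorem addClosure_le_addBall (X : ObjectProperty (ModuleCat.{u} R)) (r : ℕ) :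
    addClosure X ≤ addBall X (r + 1) := by
  induction r with
  | zero => exact le_rfl
  | succ r ih => exact ih.trans (addBall_le_succ X r)

theorem IsAdditive.addBall_le (hY : IsAdditive Y) (hext : ext Y Y ≤ Y) (h : X ≤ Y) (r : ℕ) :
    addBall X (r + 1) ≤ Y := by
  induction r with
  | zero => exact hY.addClosure_le h
  | succ r ih =>
    have := ext_mono (hY.addClosure_le ih) (hY.addClosure_le h)
    exact hY.addClosure_le (this.trans hext)

theorem IsAdditive.single_le (hY : IsAdditive Y) {G : ModuleCat.{u} R} (hG : Y G) :
    single G ≤ Y := fun _ ⟨e⟩ => hY.of_equiv e hG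

theorem IsAdditive.free (hY : IsAdditive Y) (hR : Y (ModuleCat.of R R)) (n : ℕ) :
    Y (ModuleCat.of R (Fin n → R)) :=
  hY.pi (fun _ => ModuleCat.of R R) fun _ => hR

variable (R) in
/-- The finitely generated modules. -/
def finiteModules : ObjectProperty (ModuleCat.{u} R) := fun M => Module.Finite R M

variable (R) in
theorem isAdditive_finiteModules : IsAdditive (finiteModules R) where
  retract {M N} s p h hN := by
    have : Module.Finite R N := hN
    exact Module.Finite.of_surjective p fun m => ⟨s m, LinearMap.congr_fun h m⟩
  pi {_} F h := by
    have hF : ∀ i, Module.Finite R (F i) := h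
    exact Module.Finite.pi

variable (R) in
theorem ext_finiteModules_le : ext (finiteModules R) (finiteModules R) ≤ finiteModules R := by
  rintro M ⟨A, B, hA, hB, f, g, hf, hfg, hg⟩
  have : Module.Finite R A := hA
  have : Module.Finite R B := hB
  have : Module.Finite R (LinearMap.range f) := Module.Finite.range f
  have hker : LinearMap.ker g = LinearMap.range f := LinearMap.exact_iff.mp hfg
  have : Module.Finite R (M ⧸ LinearMap.range f) := Module.Finite.equiv
    ((Submodule.quotEquivOfEq _ _ hker.symm).trans (g.quotKerEquivOfSurjective hg)).symm
  exact Module.Finite.of_submodule_quotient (LinearMap.range f)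

end Additive

/-! ### Covers with prescribed kernel: Schanuel, horseshoe and pullback -/

section Covers

variable {R : Type u} [CommRing R]

/-- `M` has a finitely generated projective cover, not necessarily minimal, with kernel in `Y`. -/
def HasCoverWithKernelIn (Y : ObjectProperty (ModuleCat.{u} R)) :
    ObjectProperty (ModuleCat.{u} R) := fun M =>
  ∃ (P : ModuleCat.{u} R) (f : P →ₗ[R] M), Module.Finite R P ∧ Module.Projective R P ∧
    Function.Surjective f ∧ Y (ModuleCat.of R (LinearMap.ker f))

variable {X X' Y Y' : ObjectProperty (ModuleCat.{u} R)}

theorem hasCoverWithKernelIn_mono (h : Y ≤ Y') :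
    HasCoverWithKernelIn Y ≤ HasCoverWithKernelIn Y' := by
  rintro M ⟨P, f, hP, hP', hf, hY⟩
  exact ⟨P, f, hP, hP', hf, h _ hY⟩

/-- A form of Schanuel's lemma: kernels of projective covers of a summand are summands. -/
theorem HasCoverWithKernelIn.ker_of_retract (hY : IsAdditive Y) {M M' : ModuleCat.{u} R}
    (h : HasCoverWithKernelIn Y M') (s : M →ₗ[R] M') (p : M' →ₗ[R] M)
    (hps : p ∘ₗ s = LinearMap.id) {P : ModuleCat.{u} R} [Module.Projective R P] (hP : Y P)
    (g : P →ₗ[R] M) (hg : Function.Surjective g) : Y (ModuleCat.of R (LinearMap.ker g)) := by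
  obtain ⟨F, f, _, _, hf, hK⟩ := h
  obtain ⟨α, hα⟩ := Module.projective_lifting_property f (s ∘ₗ g) hf
  obtain ⟨β, hβ⟩ := Module.projective_lifting_property g (p ∘ₗ f) hg
  have hα' (x : P) : f (α x) = s (g x) := LinearMap.congr_fun hα x
  have hβ' (x : F) : g (β x) = p (f x) := LinearMap.congr_fun hβ x
  have hps' (x : M) : p (s x) = x := LinearMap.congr_fun hps x
  let a : LinearMap.ker g →ₗ[R] LinearMap.ker f := α.restrict fun x hx => by
    rw [LinearMap.mem_ker] at hx ⊢
    rw [hα', hx, map_zero]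
  let b : LinearMap.ker f →ₗ[R] LinearMap.ker g := β.restrict fun x hx => by
    rw [LinearMap.mem_ker] at hx ⊢
    rw [hβ', hx, map_zero]
  let c : P →ₗ[R] LinearMap.ker g := (LinearMap.id - β ∘ₗ α).codRestrict _ fun x => by
    rw [LinearMap.mem_ker]
    simp [hα', hβ', hps']
  -- On `ker g` the composite is `βαx + (x - βαx) = x`; the second term lies in `ker g` because `gβα
  -- = pfα = psg = g`.
  refine hY.retract (N := ModuleCat.of R (LinearMap.ker f × P)) (LinearMap.prod a
    (LinearMap.ker g).subtype) (LinearMap.coprod b c) ?_ (hY.prod hK hP)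
  ext x
  simp [a, b, c]

theorem HasCoverWithKernelIn.retract (hY : IsAdditive Y) (hR : Y (ModuleCat.of R R))
    {M M' : ModuleCat.{u} R} (h : HasCoverWithKernelIn Y M') (s : M →ₗ[R] M') (p : M' →ₗ[R] M)
    (hps : p ∘ₗ s = LinearMap.id) : HasCoverWithKernelIn Y M := by
  obtain ⟨F, f, hF, _, hf, _⟩ := id h
  have hp : Function.Surjective p := fun m => ⟨s m, LinearMap.congr_fun hps m⟩
  -- A free cover is chosen because Schanuel needs the covering module itself in `Y`, and `R ∈ Y`
  -- places finite free modules there.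
  obtain ⟨n, g, hg⟩ := Module.Finite.exists_fin' R F
  have hg' : Function.Surjective (p ∘ₗ f ∘ₗ g) := hp.comp (hf.comp hg)
  exact ⟨ModuleCat.of R (Fin n → R), p ∘ₗ f ∘ₗ g, inferInstanceAs (Module.Finite R (Fin n → R)),
    inferInstanceAs (Module.Projective R (Fin n → R)), hg',
    h.ker_of_retract hY s p hps (P := ModuleCat.of R (Fin n → R)) (hY.free hR n) _ hg'⟩

theorem isAdditive_hasCoverWithKernelIn (hY : IsAdditive Y) (hR : Y (ModuleCat.of R R)) :
    IsAdditive (HasCoverWithKernelIn Y) where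
  retract s p h hN := hN.retract hY hR s p h
  pi {n} F h := by
    choose P f hP hP' hf hK using h
    let φ : ((i : Fin n) → P i) →ₗ[R] ((i : Fin n) → F i) := LinearMap.piMap f
    have hφ (x : (i : Fin n) → P i) (i : Fin n) : φ x i = f i (x i) := rfl
    let e : LinearMap.ker φ ≃ₗ[R] ((i : Fin n) → LinearMap.ker (f i)) :=
      { toFun := fun x i => ⟨x.1 i, congrFun x.2 i⟩
        invFun := fun y => ⟨fun i => (y i).1, funext fun i => (y i).2⟩
        map_add' := fun _ _ => rfl
        map_smul' := fun _ _ => rfl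
        left_inv := fun _ => rfl
        right_inv := fun _ => rfl }
    refine ⟨ModuleCat.of R ((i : Fin n) → P i), φ, Module.Finite.pi,
      
      Module.Projective.of_equiv (DFinsupp.linearEquivFunOnFintype (R := R) (M := fun i => P i)),
      fun y => ?_, ?_⟩
    · choose x hx using fun i => hf i (y i)
      exact ⟨x, funext hx⟩
    · exact hY.of_equiv e (hY.pi (fun i => ModuleCat.of R (LinearMap.ker (f i))) hK)

/-- The horseshoe lemma. -/
theorem ext_hasCoverWithKernelIn_le :
    ext (HasCoverWithKernelIn Y) (HasCoverWithKernelIn Y') ≤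
      HasCoverWithKernelIn (ext Y Y') := by
  rintro M ⟨A, B, ⟨P, π, _, _, hπ, hA⟩, ⟨Q, ρ, _, _, hρ, hB⟩, f, g, hf, hfg, hg⟩
  obtain ⟨l, hl⟩ := Module.projective_lifting_property g ρ hg
  have hl' (x : Q) : g (l x) = ρ x := LinearMap.congr_fun hl x
  let φ : P × Q →ₗ[R] M := LinearMap.coprod (f ∘ₗ π) l
  have hφ (x : P × Q) : φ x = f (π x.1) + l x.2 := rfl
  have hgφ (x : P × Q) : g (φ x) = ρ x.2 := by
    rw [hφ, map_add, hfg.apply_apply_eq_zero, zero_add, hl']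
  have hlift (m : M) (hm : g m = 0) : ∃ x, f (π x) = m := by
    obtain ⟨a, rfl⟩ := (hfg m).mp hm
    obtain ⟨x, rfl⟩ := hπ a
    exact ⟨x, rfl⟩
  refine ⟨ModuleCat.of R (P × Q), φ, inferInstanceAs (Module.Finite R (P × Q)),
    inferInstanceAs (Module.Projective R (P × Q)), fun m => ?_,
    ModuleCat.of R (LinearMap.ker π), ModuleCat.of R (LinearMap.ker ρ), hA, hB,
    (LinearMap.inl R P Q).restrict fun x hx => ?_,
    (LinearMap.snd R P Q).restrict fun x hx => ?_, ?_, ?_, ?_⟩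
  · obtain ⟨y, hy⟩ := hρ (g m)
    obtain ⟨x, hx⟩ := hlift (m - l y) (by rw [map_sub, hl', hy, sub_self])
    exact ⟨(x, y), by rw [hφ, hx, sub_add_cancel]⟩
  · rw [LinearMap.mem_ker] at hx ⊢
    rw [hφ]
    simp [hx]
  · rw [LinearMap.mem_ker] at hx ⊢
    rw [LinearMap.snd_apply, ← hgφ, hx, map_zero]
  · intro x y hxy
    exact Subtype.ext (congrArg (fun z => z.1.1) hxy)
  · rintro ⟨⟨x, y⟩, hxy⟩
    constructor
    · intro hy
      have hy0 : y = 0 := congrArg Subtype.val hy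
      subst hy0
      refine ⟨⟨x, hf ?_⟩, rfl⟩
      rw [LinearMap.mem_ker, hφ] at hxy
      simpa using hxy
    · rintro ⟨z, hz⟩
      rw [← hz]; rfl
  · rintro ⟨y, hy⟩
    obtain ⟨x, hx⟩ := hlift (l y) (by rw [hl']; exact hy)
    refine ⟨⟨(-x, y), ?_⟩, rfl⟩
    rw [LinearMap.mem_ker, hφ, map_neg, map_neg, hx, neg_add_cancel]

/-- Taking syzygies maps |G|_r into |H|_r once this holds for `G` itself: extensions are handled by
the horseshoe lemma, summands by Schanuel. Having `R` in `add H` absorbs the projective summands by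
which syzygies are ambiguous. -/
theorem addBall_le_hasCoverWithKernelIn {G H : ModuleCat.{u} R}
    (hR : addClosure (single H) (ModuleCat.of R R))
    (hG : HasCoverWithKernelIn (addClosure (single H)) G) (r : ℕ) :
    addBall (single G) (r + 1) ≤ HasCoverWithKernelIn (addBall (single H) (r + 1)) := by
  have h₁ : addClosure (single G) ≤ HasCoverWithKernelIn (addClosure (single H)) :=
    have hadd := isAdditive_hasCoverWithKernelIn (isAdditive_addClosure _) hR
    hadd.addClosure_le (hadd.single_le hG)
  induction r with
  | zero => exact h₁
  | succ r ih =>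
    refine (isAdditive_hasCoverWithKernelIn (isAdditive_addBall _ _)
      (addClosure_le_addBall _ _ _ hR)).addClosure_le ?_
    have hadd := isAdditive_hasCoverWithKernelIn (isAdditive_addBall (single H) r)
      (addClosure_le_addBall _ _ _ hR)
    exact (ext_mono (hadd.addClosure_le ih) h₁).trans (ext_hasCoverWithKernelIn_le.trans
      (hasCoverWithKernelIn_mono ((ext_mono le_addClosure le_rfl).trans le_addClosure)))

/-- If `0 → N → W → N' → 0` and `P → N'` are exact with `P` projective, then `N` is a summand of an
extension of `W` by the kernel of `P → N'`. -/
theorem addClosure_ext_of_exact {N W N' P : ModuleCat.{u} R} {f : N →ₗ[R] W} {g : W →ₗ[R] N'}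
    (hf : Function.Injective f) (hfg : Function.Exact f g) (hg : Function.Surjective g)
    [Module.Projective R P] (π : P →ₗ[R] N') (hπ : Function.Surjective π)
    (hK : X (ModuleCat.of R (LinearMap.ker π))) (hW : Y W) : addClosure (ext X Y) N := by
  obtain ⟨l, hl⟩ := Module.projective_lifting_property g π hg
  have hl' (x : P) : g (l x) = π x := LinearMap.congr_fun hl x
  -- `E` is the pullback of `P` and `W` over `N'`. Projection to `W` has kernel `ker π`; projection
  -- to `P` has kernel `N` and is split by the lift `l`, so that `(x, w) ↦ w - l x` retracts `E`
  -- onto `N`.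
  let E : Submodule R (P × W) := LinearMap.ker (LinearMap.coprod π (-g))
  have hE {z : P × W} : z ∈ E ↔ π z.1 = g z.2 := by
    simp [E, ← sub_eq_add_neg, sub_eq_zero]
  refine (isAdditive_addClosure _).retract (N := ModuleCat.of R E)
    ((LinearMap.inr R P W ∘ₗ f).codRestrict E fun x => hE.mpr ?_)
    ((LinearEquiv.ofInjective f hf).symm.toLinearMap ∘ₗ
      ((LinearMap.snd R P W - l ∘ₗ LinearMap.fst R P W) ∘ₗ E.subtype).codRestrict
        (LinearMap.range f) fun z => ?_) ?_ (le_addClosure _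
      ⟨_, W, hK, hW, (LinearMap.inl R P W ∘ₗ (LinearMap.ker π).subtype).codRestrict E
        fun x => hE.mpr ?_, LinearMap.snd R P W ∘ₗ E.subtype, ?_, ?_, ?_⟩)
  · simp [hfg.apply_apply_eq_zero]
  · have hz := hE.mp z.2
    refine (hfg _).mp ?_
    simp [hl', hz]
  · ext x
    apply hf
    have h1 (y : LinearMap.range f) : f ((LinearEquiv.ofInjective f hf).symm y) = y :=
      congrArg Subtype.val ((LinearEquiv.ofInjective f hf).apply_symm_apply y)
    exact (h1 _).trans (by change f x - l 0 = f x; rw [map_zero, sub_zero])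
  · have := x.2
    rw [LinearMap.mem_ker] at this
    simp [this]
  · intro x y hxy
    exact Subtype.ext (congrArg (fun z : E => z.1.1) hxy)
  · rintro ⟨⟨x, w⟩, hz⟩
    constructor
    · intro hw
      have hw0 : w = 0 := hw
      subst hw0
      exact ⟨⟨x, by simpa using hE.mp hz⟩, rfl⟩
    · rintro ⟨y, hy⟩
      rw [← hy]; rfl
  · intro w
    obtain ⟨x, hx⟩ := hπ (g w)
    exact ⟨⟨(x, w), hE.mpr hx⟩, rfl⟩

end Covers


/-! ### Minimal syzygies and the balls [G]_r -/

section Brackets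

variable {R : Type u} [CommRing R] [IsLocalRing R]
variable {X X' Y Y' : ObjectProperty (ModuleCat.{u} R)}

theorem isAdditive_bracket (X : ObjectProperty (ModuleCat.{u} R)) : IsAdditive (bracket X) :=
  isAdditive_addClosure _

theorem bracket_self (X : ObjectProperty (ModuleCat.{u} R)) : bracket X (ModuleCat.of R R) :=
  le_addClosure _ (Or.inl ⟨LinearEquiv.refl R R⟩)

theorem le_bracket : X ≤ bracket X := fun M hM =>
  le_addClosure M (Or.inr ⟨0, M, hM, ⟨LinearEquiv.refl R M⟩⟩)

theorem addClosure_le_bracket : addClosure X ≤ bracket X :=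
  (isAdditive_bracket X).addClosure_le le_bracket

theorem bracket_le (hY : IsAdditive Y) (hR : Y (ModuleCat.of R R))
    (hsyz : ∀ M N, Y M → IsSyzygy M N → Y N) (h : X ≤ Y) : bracket X ≤ Y := by
  have hnth (i : ℕ) (A N : ModuleCat.{u} R) (hA : Y A) (hN : IsNthSyzygy i A N) : Y N := by
    induction i generalizing A with
    | zero => exact hY.of_equiv hN.some hA
    | succ i ih =>
      obtain ⟨K, hK, hN⟩ := hN
      exact ih K (hsyz A K hA hK) hN
  refine hY.addClosure_le ?_
  rintro N (⟨⟨e⟩⟩ | ⟨i, A, hA, hN⟩)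
  · exact hY.of_equiv (N := ModuleCat.of R R) e hR
  · exact hnth i A N (h A hA) hN

theorem ball_le (hY : IsAdditive Y) (hR : Y (ModuleCat.of R R))
    (hsyz : ∀ M N, Y M → IsSyzygy M N → Y N) (hext : ext Y Y ≤ Y) (h : X ≤ Y) (r : ℕ) :
    ball X (r + 1) ≤ Y := by
  induction r with
  | zero => exact bracket_le hY hR hsyz h
  | succ r ih =>
    have := ext_mono (bracket_le hY hR hsyz ih) (bracket_le hY hR hsyz h)
    exact bracket_le hY hR hsyz (this.trans hext)

theorem addBall_le_ball (X : ObjectProperty (ModuleCat.{u} R)) (r : ℕ) :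
    addBall X (r + 1) ≤ ball X (r + 1) := by
  induction r with
  | zero => exact addClosure_le_bracket
  | succ r ih =>
    have := ext_mono ((addClosure_mono ih).trans addClosure_le_bracket)
      (addClosure_le_bracket (X := X))
    exact (addClosure_mono this).trans addClosure_le_bracket

theorem IsSyzygy.of_equiv {A N L : ModuleCat.{u} R} (h : IsSyzygy N L) (e : N ≃ₗ[R] A) :
    IsSyzygy A L := by
  obtain ⟨n, f, hf, hmin, ⟨e'⟩⟩ := h
  have hker : LinearMap.ker (e.toLinearMap ∘ₗ f) = LinearMap.ker f := LinearEquiv.ker_comp e f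
  exact ⟨n, e.toLinearMap ∘ₗ f, e.surjective.comp hf, hker ▸ hmin,
    ⟨e'.trans (LinearEquiv.ofEq _ _ hker.symm)⟩⟩

/-- The recursive definition peels off the first syzygy; here one is appended at the far end. -/
theorem IsNthSyzygy.isSyzygy {i : ℕ} {A N L : ModuleCat.{u} R} (h : IsNthSyzygy i A N)
    (hL : IsSyzygy N L) : IsNthSyzygy (i + 1) A L := by
  induction i generalizing A with
  | zero => exact ⟨L, hL.of_equiv h.some, ⟨LinearEquiv.refl R L⟩⟩
  | succ i ih =>
    obtain ⟨K, hK, h⟩ := h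
    exact ⟨K, hK, ih h⟩

theorem IsSyzygy.hasCoverWithKernelIn (hY : IsAdditive Y) {M N : ModuleCat.{u} R}
    (h : IsSyzygy M N) (hN : Y N) : HasCoverWithKernelIn Y M := by
  obtain ⟨n, f, hf, -, ⟨e⟩⟩ := h
  exact ⟨ModuleCat.of R (Fin n → R), f, inferInstanceAs (Module.Finite R (Fin n → R)),
    inferInstanceAs (Module.Projective R (Fin n → R)), hf, hY.of_equiv e.symm hN⟩

theorem HasCoverWithKernelIn.of_isSyzygy (hY : IsAdditive Y) (hR : Y (ModuleCat.of R R))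
    {M N : ModuleCat.{u} R} (h : HasCoverWithKernelIn Y M) (hN : IsSyzygy M N) : Y N := by
  obtain ⟨n, f, hf, -, ⟨e⟩⟩ := hN
  exact hY.of_equiv (N := ModuleCat.of R (LinearMap.ker f)) e
    (h.ker_of_retract hY LinearMap.id LinearMap.id rfl
    (P := ModuleCat.of R (Fin n → R)) (hY.free hR n) f hf)

/-- A cover with the least number of generators is minimal: a relation with a unit coordinate would
make that generator redundant. -/
theorem exists_isSyzygy (M : ModuleCat.{u} R) [hM : Module.Finite R M] :
    ∃ N : ModuleCat.{u} R, IsSyzygy M N := by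
  classical
  have hex : ∃ n, ∃ f : (Fin n → R) →ₗ[R] M, Function.Surjective f :=
    Module.Finite.exists_fin' R M
  obtain ⟨f, hf⟩ := Nat.find_spec hex
  have hmin {n : ℕ} (h : ∃ f : (Fin n → R) →ₗ[R] M, Function.Surjective f) :
      Nat.find hex ≤ n := Nat.find_min' hex h
  generalize Nat.find hex = n at f hf hmin
  refine ⟨ModuleCat.of R (LinearMap.ker f), n, f, hf, fun v hv => ?_, ⟨LinearEquiv.refl R _⟩⟩
  have hmem (i : Fin n) : v i ∈ maximalIdeal R := by
    by_contra hi
    obtain ⟨a, ha⟩ : IsUnit (v i) := by simpa using hi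
    cases n with
    | zero => exact i.elim0
    | succ n =>
      -- the generator with index `i` is redundant
      let b : Fin (n + 1) → M := fun j => f (Pi.single j 1)
      have hfb (w : Fin (n + 1) → R) : f w = ∑ j, w j • b j := by
        conv_lhs => rw [pi_eq_sum_univ' w]
        simp [b]
      let S : Submodule R M := Submodule.span R (Set.range (b ∘ i.succAbove))
      have hS (j : Fin n) : b (i.succAbove j) ∈ S := Submodule.subset_span ⟨j, rfl⟩
      have hbi : b i ∈ S := by
        have h0 : v i • b i + ∑ j, v (i.succAbove j) • b (i.succAbove j) = 0 := by
          rw [← Fin.sum_univ_succAbove (fun j => v j • b j) i, ← hfb]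
          exact hv
        have h1 : (a : R) • b i ∈ S := by
          rw [ha, eq_neg_of_add_eq_zero_left h0]
          exact S.neg_mem (S.sum_mem fun j _ => S.smul_mem _ (hS j))
        simpa [smul_smul] using S.smul_mem (↑a⁻¹ : R) h1
      have htop : S = ⊤ := by
        refine eq_top_iff.mpr fun m _ => ?_
        obtain ⟨w, rfl⟩ := hf m
        rw [hfb, Fin.sum_univ_succAbove _ i]
        exact S.add_mem (S.smul_mem _ hbi) (S.sum_mem fun j _ => S.smul_mem _ (hS j))
      refine absurd (hmin (n := n) ⟨Fintype.linearCombination R (b ∘ i.succAbove), ?_⟩)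
        (by omega)
      rw [← LinearMap.range_eq_top, Fintype.range_linearCombination]
      exact htop
  rw [← Finset.univ_sum_single v]
  refine Submodule.sum_mem _ fun i _ => ?_
  have h : (Pi.single i (v i) : Fin n → R) = v i • Pi.single i 1 := by
    rw [← Pi.single_smul, smul_eq_mul, mul_one]
  rw [h]
  exact Submodule.smul_mem_smul (hmem i) trivial

variable [IsNoetherianRing R]

theorem IsSyzygy.finite {M N : ModuleCat.{u} R} (h : IsSyzygy M N) : Module.Finite R N := by
  obtain ⟨n, f, -, -, ⟨e⟩⟩ := h
  exact Module.Finite.equiv e.symm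

theorem bracket_le_finiteModules (h : X ≤ finiteModules R) : bracket X ≤ finiteModules R :=
  bracket_le (isAdditive_finiteModules R) (inferInstanceAs (Module.Finite R R))
    (fun _ _ _ h => h.finite) h

/-- The generators of `[X]` are stable under syzygies, up to the zero syzygy of `R`, and covers pass
to sums and summands. -/
theorem bracket_le_hasCoverWithKernelIn_self (h : X ≤ finiteModules R) :
    bracket X ≤ HasCoverWithKernelIn (bracket X) := by
  have hadd := isAdditive_hasCoverWithKernelIn (isAdditive_bracket X) (bracket_self X)
  refine hadd.addClosure_le fun N hN => ?_
  have : Module.Finite R N := bracket_le_finiteModules h N (le_addClosure N hN)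
  obtain ⟨L, hL⟩ := exists_isSyzygy N
  refine hL.hasCoverWithKernelIn (isAdditive_bracket X) ?_
  rcases hN with ⟨⟨e⟩⟩ | ⟨i, A, hA, hN⟩
  -- Here `N ≅ R` is covered by `R` with kernel 0; Schanuel then puts the given syzygy `L` in `[X]`.
  · have h0 : HasCoverWithKernelIn (bracket X) N := by
      refine ⟨ModuleCat.of R R, e.symm.toLinearMap, inferInstanceAs (Module.Finite R R),
        inferInstanceAs (Module.Projective R R), e.symm.surjective, ?_⟩
      have : Subsingleton (LinearMap.ker e.symm.toLinearMap) :=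
        Submodule.subsingleton_iff_eq_bot.mpr (LinearEquiv.ker e.symm)
      exact (isAdditive_bracket X).of_subsingleton
        (ModuleCat.of R (LinearMap.ker e.symm.toLinearMap))
    exact h0.of_isSyzygy (isAdditive_bracket X) (bracket_self X) hL
  · exact le_addClosure L (Or.inr ⟨i + 1, A, hA, hN.isSyzygy hL⟩)

/-- A syzygy of a module having a cover with kernel in `[Y]` lies in `[Y]`, and so has such a cover
again. -/
theorem bracket_le_hasCoverWithKernelIn (hY : Y ≤ finiteModules R)
    (h : X ≤ HasCoverWithKernelIn (bracket Y)) : bracket X ≤ HasCoverWithKernelIn (bracket Y) := by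
  have hadd := isAdditive_hasCoverWithKernelIn (isAdditive_bracket Y) (bracket_self Y)
  refine bracket_le hadd ?_ (fun M N hM hN => ?_) h
  · exact bracket_le_hasCoverWithKernelIn_self hY _ (bracket_self Y)
  · exact bracket_le_hasCoverWithKernelIn_self hY _
      (hM.of_isSyzygy (isAdditive_bracket Y) (bracket_self Y) hN)

theorem ball_single_le_finiteModules {H : ModuleCat.{u} R} (hH : Module.Finite R H) (r : ℕ) :
    ball (single H) (r + 1) ≤ finiteModules R :=
  ball_le (isAdditive_finiteModules R) (inferInstanceAs (Module.Finite R R))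
    (fun _ _ _ h => h.finite) (ext_finiteModules_le R)
    ((isAdditive_finiteModules R).single_le hH) r

theorem ball_le_hasCoverWithKernelIn {G H : ModuleCat.{u} R} (hH : Module.Finite R H)
    (hG : HasCoverWithKernelIn (bracket (single H)) G) (r : ℕ) :
    ball (single G) (r + 1) ≤ HasCoverWithKernelIn (ball (single H) (r + 1)) := by
  have hfin : single H ≤ finiteModules R := (isAdditive_finiteModules R).single_le hH
  have h₁ : bracket (single G) ≤ HasCoverWithKernelIn (bracket (single H)) :=
    bracket_le_hasCoverWithKernelIn hfin ((isAdditive_hasCoverWithKernelIn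
      (isAdditive_bracket _) (bracket_self _)).single_le hG)
  induction r with
  | zero => exact h₁
  | succ r ih =>
    have hball := ball_single_le_finiteModules hH r
    have h₂ : bracket (ball (single G) (r + 1)) ≤
        HasCoverWithKernelIn (bracket (ball (single H) (r + 1))) :=
      bracket_le_hasCoverWithKernelIn hball (ih.trans (hasCoverWithKernelIn_mono le_bracket))
    refine bracket_le_hasCoverWithKernelIn ?_ ?_
    · exact (ext_mono (bracket_le_finiteModules hball) (bracket_le_finiteModules hfin)).trans
        (ext_finiteModules_le R)
    · exact (ext_mono h₂ h₁).trans
        (ext_hasCoverWithKernelIn_le.trans (hasCoverWithKernelIn_mono le_bracket))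

end Brackets

/-! ### Improving the depth of the centre -/

section Center

variable {R : Type u} [CommRing R] [IsLocalRing R] [IsNoetherianRing R]

theorem isAdditive_cm {d : ℕ} (hd : ringKrullDim R = d) : IsAdditive (CM R) where
  retract {M N} s p h hN := by
    rw [cm_iff hd] at hN ⊢
    exact ⟨(isAdditive_finiteModules R).retract s p h hN.1, hN.2.of_retract s p h⟩
  pi F h := by
    simp only [cm_iff hd] at h ⊢
    exact ⟨(isAdditive_finiteModules R).pi F fun i => (h i).1, DepthGE.pi fun i => (h i).2⟩

theorem ext_cm_le {d : ℕ} (hd : ringKrullDim R = d) : ext (CM R) (CM R) ≤ CM R := by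
  rintro M ⟨A, B, hA, hB, f, g, hf, hfg, hg⟩
  rw [cm_iff hd] at hA hB ⊢
  exact ⟨ext_finiteModules_le R M ⟨A, B, hA.1, hB.1, f, g, hf, hfg, hg⟩,
    DepthGE.middle hf hfg hg hA.2 hB.2⟩

theorem cm_self {d : ℕ} (hd : ringKrullDim R = d) (hR : IsCohenMacaulayRing R) :
    CM R (ModuleCat.of R R) :=
  (cm_iff hd _).mpr ⟨inferInstanceAs (Module.Finite R R), hR.depthGE hd⟩

theorem DepthGE.free {d : ℕ} (hd : ringKrullDim R = d) (hR : IsCohenMacaulayRing R) (n : ℕ) :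
    DepthGE d (ModuleCat.of R (Fin n → R)) :=
  DepthGE.pi (F := fun _ => ModuleCat.of R R) fun _ => hR.depthGE hd

/-- The depth lemma; `j < d` is needed because the gain is capped by the depth `d` of free modules.
-/
theorem IsSyzygy.depthGE_succ {d : ℕ} (hd : ringKrullDim R = d) (hR : IsCohenMacaulayRing R)
    {M N : ModuleCat.{u} R} (h : IsSyzygy M N) {j : ℕ} (hj : j < d) (hM : DepthGE j M) :
    DepthGE (j + 1) N := by
  obtain ⟨n, f, hf, -, ⟨e⟩⟩ := h
  refine DepthGE.of_equiv (M' := ModuleCat.of R (LinearMap.ker f)) ?_ e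
  exact DepthGE.left (B := ModuleCat.of R (Fin n → R)) (LinearMap.ker f).injective_subtype
    (LinearMap.exact_subtype_ker_map f) hf ((DepthGE.free hd hR n).mono hj) hM

theorem cm_of_isSyzygy {d : ℕ} (hd : ringKrullDim R = d) (hR : IsCohenMacaulayRing R)
    {M N : ModuleCat.{u} R} (hM : CM R M) (h : IsSyzygy M N) : CM R N := by
  refine (cm_iff hd N).mpr ⟨h.finite, ?_⟩
  obtain ⟨n, f, hf, -, ⟨e⟩⟩ := h
  refine DepthGE.of_equiv (M' := ModuleCat.of R (LinearMap.ker f)) ?_ e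
  exact DepthGE.left_of_le (B := ModuleCat.of R (Fin n → R)) (LinearMap.ker f).injective_subtype
    (LinearMap.exact_subtype_ker_map f) hf (DepthGE.free hd hR n) ((cm_iff hd M).mp hM).2

/-- The center obtained from `G` by passing to `ΩG ⊕ R ⊕ ω`. -/
theorem exists_next_center {d : ℕ} (hd : ringKrullDim R = d) (hR : IsCohenMacaulayRing R)
    {ω : ModuleCat.{u} R} (hω : CM R ω) {j : ℕ} (hj : j < d) {G : ModuleCat.{u} R}
    (hfin : Module.Finite R G) (hG : DepthGE j G) :
    ∃ H : ModuleCat.{u} R, Module.Finite R H ∧ DepthGE (j + 1) H ∧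
      addClosure (single H) (ModuleCat.of R R) ∧ addClosure (single H) ω ∧
      HasCoverWithKernelIn (addClosure (single H)) G := by
  obtain ⟨K, hK⟩ := exists_isSyzygy G
  have := hK.finite
  rw [cm_iff hd] at hω
  have := hω.1
  let H : ModuleCat.{u} R := ModuleCat.of R (K × (ModuleCat.of R (R × ω)))
  have hH : addClosure (single H) H := le_addClosure H ⟨LinearEquiv.refl R H⟩
  have hadd := isAdditive_addClosure (single H)
  refine ⟨H, inferInstanceAs (Module.Finite R (K × R × ω)),
    DepthGE.prod (hK.depthGE_succ hd hR hj hG)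
      (DepthGE.prod ((hR.depthGE hd).mono hj) (hω.2.mono hj)), ?_, ?_,
    hK.hasCoverWithKernelIn hadd ?_⟩
  · exact hadd.retract (N := H) (LinearMap.inr R K (R × ω) ∘ₗ LinearMap.inl R R ω)
      (LinearMap.fst R R ω ∘ₗ LinearMap.snd R K (R × ω)) (by ext; rfl) hH
  · exact hadd.retract (N := H) (LinearMap.inr R K (R × ω) ∘ₗ LinearMap.inr R R ω)
      (LinearMap.snd R R ω ∘ₗ LinearMap.snd R K (R × ω)) (by ext; rfl) hH
  · exact hadd.retract (N := H) (LinearMap.inl R K (R × ω)) (LinearMap.fst R K (R × ω))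
      (by ext; rfl) hH

/-- If all maximal Cohen-Macaulay modules have covers with kernel in `X`, they are summands of
extensions of sums of copies of `ω` by modules in `X`. -/
theorem cm_le_addClosure_ext {d : ℕ} (hd : ringKrullDim R = d) (hR : IsCohenMacaulayRing R)
    {ω : ModuleCat.{u} R} (hω : IsCanonicalModule ω) {X Y : ObjectProperty (ModuleCat.{u} R)}
    (hX : CM R ≤ HasCoverWithKernelIn X) (hY : IsAdditive Y) (hωY : Y ω) :
    CM R ≤ addClosure (ext X Y) := by
  intro N hN
  obtain ⟨n, F, hF, hC⟩ := exists_embedding_pi hd hR hω hN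
  -- The cover is taken of the cokernel, which is again maximal Cohen–Macaulay, and not of `N`.
  obtain ⟨P, π, _, _, hπ, hK⟩ := hX _ hC
  exact addClosure_ext_of_exact (W := ModuleCat.of R (Fin n → ω))
    (N' := ModuleCat.of R ((Fin n → ω) ⧸ LinearMap.range F)) hF
    (LinearMap.exact_map_mkQ_range F) (Submodule.mkQ_surjective _) π hπ hK
    (hY.pi (fun _ => ω) fun _ => hωY)

/-- Each step trades one unit of radius for one of depth: the kernels lie in the old-size ball
around the new centre, and the extension by copies of ω, a summand of that centre, adds one. -/
theorem exists_center_addBall {d : ℕ} (hd : ringKrullDim R = d) (hR : IsCohenMacaulayRing R)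
    {ω : ModuleCat.{u} R} (hω : IsCanonicalModule ω) {n : ℕ} {G : ModuleCat.{u} R}
    (hfin : Module.Finite R G) (hG : CM R ≤ addBall (single G) (n + 1)) (j : ℕ) (hj : j ≤ d) :
    ∃ H : ModuleCat.{u} R, Module.Finite R H ∧ DepthGE j H ∧
      CM R ≤ addBall (single H) (n + j + 1) := by
  induction j with
  | zero => exact ⟨G, hfin, fun i hi => absurd hi (Nat.not_lt_zero i), hG⟩
  | succ j ih =>
    obtain ⟨G', hfin', hdepth, hG'⟩ := ih (by omega)
    obtain ⟨H, hH, hHd, hHR, hHω, hcov⟩ :=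
      exists_next_center hd hR hω.maximal_cohenMacaulay hj hfin' hdepth
    refine ⟨H, hH, hHd, ?_⟩
    have h₁ := hG'.trans (addBall_le_hasCoverWithKernelIn hHR hcov (n + j))
    exact (cm_le_addClosure_ext hd hR hω h₁ (isAdditive_addClosure _) hHω).trans
      (addClosure_mono (ext_mono le_addClosure le_rfl))

theorem exists_center_ball {d : ℕ} (hd : ringKrullDim R = d) (hR : IsCohenMacaulayRing R)
    {ω : ModuleCat.{u} R} (hω : IsCanonicalModule ω) {n : ℕ} {G : ModuleCat.{u} R}
    (hfin : Module.Finite R G) (hG : CM R ≤ ball (single G) (n + 1)) (j : ℕ) (hj : j ≤ d) :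
    ∃ H : ModuleCat.{u} R, Module.Finite R H ∧ DepthGE j H ∧
      CM R ≤ ball (single H) (n + j + 1) := by
  induction j with
  | zero => exact ⟨G, hfin, fun i hi => absurd hi (Nat.not_lt_zero i), hG⟩
  | succ j ih =>
    obtain ⟨G', hfin', hdepth, hG'⟩ := ih (by omega)
    -- That `R` lies in `add H` is not needed here, since brackets always contain `R`.
    obtain ⟨H, hH, hHd, -, hHω, hcov⟩ :=
      exists_next_center hd hR hω.maximal_cohenMacaulay hj hfin' hdepth
    refine ⟨H, hH, hHd, ?_⟩
    have h₁ := hG'.trans (ball_le_hasCoverWithKernelIn hH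
      (hasCoverWithKernelIn_mono addClosure_le_bracket _ hcov) (n + j))
    exact (cm_le_addClosure_ext hd hR hω h₁ (isAdditive_bracket _)
      (addClosure_le_bracket _ hHω)).trans
      ((addClosure_mono (ext_mono le_bracket le_rfl)).trans addClosure_le_bracket)

/-- At `j = d` the centre is maximal Cohen–Macaulay, so its balls stay inside `CM R` and the
inclusion becomes an equality. -/
theorem rank_cm_le {d : ℕ} (hd : ringKrullDim R = d) (hR : IsCohenMacaulayRing R)
    {ω : ModuleCat.{u} R} (hω : IsCanonicalModule ω) {n : ℕ} {G : ModuleCat.{u} R}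
    (hfin : Module.Finite R G) (hG : CM R ≤ addBall (single G) (n + 1)) :
    rank (CM R) ≤ (n + d : ℕ) := by
  obtain ⟨H, hH, hHd, hle⟩ := exists_center_addBall hd hR hω hfin hG d le_rfl
  refine iInf₂_le (n + d) ⟨H, hH, le_antisymm hle ?_⟩
  exact (isAdditive_cm hd).addBall_le (ext_cm_le hd)
    ((isAdditive_cm hd).single_le ((cm_iff hd H).mpr ⟨hH, hHd⟩)) _

theorem dim_cm_le {d : ℕ} (hd : ringKrullDim R = d) (hR : IsCohenMacaulayRing R)
    {ω : ModuleCat.{u} R} (hω : IsCanonicalModule ω) {n : ℕ} {G : ModuleCat.{u} R}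
    (hfin : Module.Finite R G) (hG : CM R ≤ ball (single G) (n + 1)) :
    dim (CM R) ≤ (n + d : ℕ) := by
  obtain ⟨H, hH, hHd, hle⟩ := exists_center_ball hd hR hω hfin hG d le_rfl
  refine iInf₂_le (n + d) ⟨H, hH, le_antisymm hle ?_⟩
  exact ball_le (isAdditive_cm hd) (cm_self hd hR) (fun _ _ => cm_of_isSyzygy hd hR)
    (ext_cm_le hd) ((isAdditive_cm hd).single_le ((cm_iff hd H).mpr ⟨hH, hHd⟩)) _

end Center

/-! ### Comparison of the four invariants -/

section Invariants

theorem exists_eq_iInf_of_lt_top {P : ℕ → Prop} (h : (⨅ (n : ℕ) (_ : P n), (n : ℕ∞)) < ⊤) :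
    ∃ n, P n ∧ (⨅ (n : ℕ) (_ : P n), (n : ℕ∞)) = n := by
  classical
  have hex : ∃ n, P n := by
    by_contra hP
    push Not at hP
    simp [hP] at h
  exact ⟨Nat.find hex, Nat.find_spec hex, le_antisymm (iInf₂_le _ (Nat.find_spec hex))
    (le_iInf₂ fun m hm => by exact_mod_cast Nat.find_min' hex hm)⟩

/-- The product exceeds `n + d` by `dn + 1`. -/
theorem coe_lt_add_one_mul_add_one {a : ℕ∞} {n d : ℕ} (h : a ≤ (n + d : ℕ)) :
    (a : WithBot ℕ∞) < ((d : WithBot ℕ∞) + 1) * (((n : ℕ∞) : WithBot ℕ∞) + 1) := by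
  lift a to ℕ using ne_top_of_le_ne_top (ENat.natCast_ne_top _) h
  have h1 : a ≤ n + d := by exact_mod_cast h
  have h2 : a < (d + 1) * (n + 1) := by nlinarith [Nat.zero_le (d * n)]
  exact_mod_cast h2

variable {R : Type u} [CommRing R]

theorem size_le_rank (X : ObjectProperty (ModuleCat.{u} R)) : size X ≤ rank X :=
  le_iInf₂ fun n ⟨G, hG, h⟩ => iInf₂_le n ⟨G, hG, h.le⟩

variable [IsLocalRing R]

theorem radius_le_dim (X : ObjectProperty (ModuleCat.{u} R)) : radius X ≤ dim X :=
  le_iInf₂ fun n ⟨G, hG, h⟩ => iInf₂_le n ⟨G, hG, h.le⟩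

theorem radius_le_size (X : ObjectProperty (ModuleCat.{u} R)) : radius X ≤ size X :=
  le_iInf₂ fun n ⟨G, hG, h⟩ => iInf₂_le n ⟨G, hG, h.trans (addBall_le_ball _ n)⟩

end Invariants

end ModSubcat

theorem proposition12 (R : Type u) [CommRing R] [IsNoetherianRing R] [IsLocalRing R]
    (hR : ModSubcat.IsCohenMacaulayRing R)
    (hω : ∃ ω : ModuleCat.{u} R, ModSubcat.IsCanonicalModule ω) :
    (ModSubcat.size (ModSubcat.CM R) < ⊤ →
      (ModSubcat.rank (ModSubcat.CM R) : WithBot ℕ∞) <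
        (ringKrullDim R + 1) * ((ModSubcat.size (ModSubcat.CM R) : WithBot ℕ∞) + 1)) ∧
    (ModSubcat.radius (ModSubcat.CM R) < ⊤ →
      (ModSubcat.dim (ModSubcat.CM R) : WithBot ℕ∞) <
        (ringKrullDim R + 1) * ((ModSubcat.radius (ModSubcat.CM R) : WithBot ℕ∞) + 1)) ∧
    (ModSubcat.rank (ModSubcat.CM R) < ⊤ ↔ ModSubcat.size (ModSubcat.CM R) < ⊤) ∧
    (ModSubcat.size (ModSubcat.CM R) < ⊤ → ModSubcat.dim (ModSubcat.CM R) < ⊤) ∧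
    (ModSubcat.dim (ModSubcat.CM R) < ⊤ ↔ ModSubcat.radius (ModSubcat.CM R) < ⊤) := by
  obtain ⟨ω, hω⟩ := hω
  -- The type-one condition also supplies the dimension as a natural number.
  obtain ⟨d, hd, -⟩ := hω.type_one
  have hrank (h : ModSubcat.size (ModSubcat.CM R) < ⊤) : ∃ n : ℕ,
      ModSubcat.size (ModSubcat.CM R) = n ∧ ModSubcat.rank (ModSubcat.CM R) ≤ (n + d : ℕ) := by
    obtain ⟨n, ⟨G, hG, hle⟩, hn⟩ := ModSubcat.exists_eq_iInf_of_lt_top h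
    exact ⟨n, hn, ModSubcat.rank_cm_le hd.symm hR hω hG hle⟩
  have hdim (h : ModSubcat.radius (ModSubcat.CM R) < ⊤) : ∃ n : ℕ,
      ModSubcat.radius (ModSubcat.CM R) = n ∧ ModSubcat.dim (ModSubcat.CM R) ≤ (n + d : ℕ) := by
    obtain ⟨n, ⟨G, hG, hle⟩, hn⟩ := ModSubcat.exists_eq_iInf_of_lt_top h
    exact ⟨n, hn, ModSubcat.dim_cm_le hd.symm hR hω hG hle⟩
  have hdim_lt (h : ModSubcat.radius (ModSubcat.CM R) < ⊤) :
      ModSubcat.dim (ModSubcat.CM R) < ⊤ := by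
    obtain ⟨n, -, hn⟩ := hdim h
    exact hn.trans_lt (ENat.natCast_lt_top _)
  refine ⟨fun h => ?_, fun h => ?_, ⟨(ModSubcat.size_le_rank _).trans_lt, fun h => ?_⟩,
    fun h => hdim_lt ((ModSubcat.radius_le_size _).trans_lt h),
    ⟨(ModSubcat.radius_le_dim _).trans_lt, hdim_lt⟩⟩
  · obtain ⟨n, hn, hle⟩ := hrank h
    rw [hn, ← hd]
    exact ModSubcat.coe_lt_add_one_mul_add_one hle
  · obtain ⟨n, hn, hle⟩ := hdim h
    rw [hn, ← hd]
    exact ModSubcat.coe_lt_add_one_mul_add_one hle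
  · obtain ⟨n, -, hn⟩ := hrank h
    exact hn.trans_lt (ENat.natCast_lt_top _)
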